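/- Let $H(\mathbb C)$ be the algebra of entire functions with the topology of uniform convergence on compact sets, and let $D$ be complex differentiation. For a non-constant entire function $\Phi$ put $M(r)=\sup_{|z|\le r}|\Phi(z)|$; its order is $\rho=\limsup_{r\to\infty}\frac{\log\log M(r)}{\log r}$, and if $\rho<\infty$ its type is $\limsup_{r\to\infty}r^{-\rho}\log M(r)$. We say that $\Phi$ is of subexponential growth if $\rho<1$, or if $\rho=1$ and $\Phi$ has type $0$. Let $\Phi(z)=\sum_{n=0}^\infty a_nz^n$ be a non-constant entire function of subexponential growth with $|\Phi(0)|=1$. Then $\Phi(D)f=\sum_{n=0}^\infty a_nD^nf$ $(f\in H(\mathbb C))$ converges in $H(\mathbb C)$ and defines a continuous linear operator $\Phi(D)$ on $H(\mathbb C)$, and $\Phi(D)$ has a hypercyclic algebra: there is a non-zero (not necessarily unital) subalgebra $A$ of $H(\mathbb C)$ such that for every non-zero $f\in A$ the orbit $\{\Phi(D)^nf : n\ge 0\}$ is dense in $H(\mathbb C)$. -/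

import Mathlib

open Filter Topology

noncomputable section

/-- The algebra `H(ℂ)` of entire functions, with pointwise operations. As a subalgebra of `C(ℂ, ℂ)`
it carries the compact-open topology. -/
def EntireFunctions : Subalgebra ℂ C(ℂ, ℂ) where
  carrier := {f | Differentiable ℂ (f : ℂ → ℂ)}
  mul_mem' hf hg := Differentiable.mul hf hg
  one_mem' := differentiable_const (1 : ℂ)
  add_mem' hf hg := Differentiable.add hf hg
  zero_mem' := differentiable_const (0 : ℂ)
  algebraMap_mem' c := differentiable_const c

namespace EntireFunctions

/-- An entire function, viewed as a function on `ℂ`. -/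
instance : CoeFun EntireFunctions (fun _ => ℂ → ℂ) := ⟨fun f => (f : C(ℂ, ℂ))⟩

theorem differentiable (f : EntireFunctions) : Differentiable ℂ (f : ℂ → ℂ) := f.2

theorem differentiable_deriv (f : EntireFunctions) : Differentiable ℂ (deriv f) :=
  fun z => ((differentiable f).analyticAt z).deriv.differentiableAt

/-- The operator `D` of complex differentiation on `H(ℂ)`. -/
def D : EntireFunctions →ₗ[ℂ] EntireFunctions where
  toFun f := ⟨⟨deriv f, (differentiable_deriv f).continuous⟩, differentiable_deriv f⟩
  map_add' f g := by
    apply Subtype.ext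
    ext z
    exact deriv_add (differentiable f z) (differentiable g z)
  map_smul' c f := by
    apply Subtype.ext
    ext z
    exact deriv_const_smul c (differentiable f z)

/-- The `n`-th Taylor coefficient of `Φ` at the origin. -/
def coeff (Φ : EntireFunctions) (n : ℕ) : ℂ :=
  iteratedDeriv n Φ 0 / (n.factorial : ℂ)

/-- `T` is the operator `Φ(D)`, that is, `T f = ∑ aₙ Dⁿ f` for every entire function `f`, where
`Φ(z) = ∑ aₙ zⁿ` and the series converges in `H(ℂ)`. -/
def IsSymbolOperator (Φ : EntireFunctions) (T : EntireFunctions →L[ℂ] EntireFunctions) : Prop :=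
  ∀ f : EntireFunctions, HasSum (fun n : ℕ => coeff Φ n • (D ^ n) f) (T f)

/-- `f` is a constant function. -/
def IsConstant (f : EntireFunctions) : Prop := ∃ c : ℂ, ∀ z : ℂ, f z = c

/-- The maximum modulus `M(r) = sup_{|z| ≤ r} |f(z)|`. -/
def maxModulus (f : EntireFunctions) (r : ℝ) : ℝ :=
  sSup ((fun z : ℂ => ‖f z‖) '' Metric.closedBall 0 r)

open Classical in
/-- The order of an entire function: `limsup_{r → ∞} log log M(r) / log r`, and `0` for constants. -/
def growthOrder (f : EntireFunctions) : EReal :=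
  if IsConstant f then 0
  else limsup (fun r : ℝ =>
    ((Real.log (Real.log (maxModulus f r)) / Real.log r : ℝ) : EReal)) atTop

/-- `limsup_{r → ∞} r ^ (-ρ) log M(r)`, which is the type of `f` when `f` has order `ρ`. -/
def growthType (f : EntireFunctions) (ρ : ℝ) : EReal :=
  limsup (fun r : ℝ => ((r ^ (-ρ) * Real.log (maxModulus f r) : ℝ) : EReal)) atTop

/-- `f` is of growth `(ρ, τ)`: of order less than `ρ`, or of order `ρ` and type at most `τ`. -/
def IsOfGrowth (f : EntireFunctions) (ρ τ : ℝ) : Prop :=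
  growthOrder f < (ρ : EReal) ∨ (growthOrder f = (ρ : EReal) ∧ growthType f ρ ≤ (τ : EReal))

/-- Subexponential growth is growth `(1, 0)`. -/
def IsOfSubexponentialGrowth (f : EntireFunctions) : Prop := IsOfGrowth f 1 0

end EntireFunctions

/-- `x` is a hypercyclic vector for `T`: its orbit `{Tⁿ x : n ≥ 0}` is dense. -/
def IsHypercyclicVector {X : Type*} [AddCommGroup X] [Module ℂ X] [TopologicalSpace X]
    (T : X →L[ℂ] X) (x : X) : Prop :=
  Dense (Set.range fun n : ℕ => (T ^ n) x)

/-- `A` is a hypercyclic algebra for `T`: a nonzero, not necessarily unital, subalgebra all of whose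
nonzero elements are hypercyclic vectors for `T`. -/
def IsHypercyclicAlgebra {X : Type*} [Ring X] [Algebra ℂ X] [TopologicalSpace X]
    (T : X →L[ℂ] X) (A : NonUnitalSubalgebra ℂ X) : Prop :=
  A ≠ ⊥ ∧ ∀ x ∈ A, x ≠ 0 → IsHypercyclicVector T x

end

/-! ### The complete separable algebra of entire functions -/

namespace EntireFunctions

/-! By Baire category (`exists_isHypercyclicAlgebra`), it is enough to find, for every `m ≥ 1` and
open `U`, `V`, `W ∋ 0`, some `u ∈ U` and one `N` with `T^N (u^m) ∈ V` and `T^N (u^n) ∈ W` for `1 ≤ n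
< m`. For generic `u`, the top-degree term of `P(u)` can then be steered anywhere while the lower
ones become negligible.

Exponentials `e^{cz}` are eigenvectors of `Φ(D)` with eigenvalue `Φ(c)`, and those with frequencies
in any segment span a dense subspace (`dense_span_expFun`). Take `u = ∑ x_a e^{p_a w₀ z} + ∑
y_b^{1/m} σ_b^N e^{(v + r_b w) z / m}` with `σ_b^m = 1/Φ(v + r_b w)`. Expanding `u^n`, each product
of exponentials acquires an `N`-th power of a fixed factor under `T^N`. The factor is `1` for the
`m`-th power of a single expanding exponential, and these powers add up to the target in `V`. All
other factors must have modulus below `1` (`norm_prod_sum_lt_one`).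

This is arranged by the geometry of `|Φ|` near `0` (`exists_geometry`). Write `Φ = Φ(0) e^L`.
Subexponential growth prevents `Φ` from being a multiple of an exponential, so `L(z) = cz + z^q
ψ(z)` with `q ≥ 2` and `ψ(0) ≠ 0`. On one ray `|Φ| < 1`; on another `log |Φ|` grows superlinearly,
which handles mixed products; and near its point `v`, `log |Φ|` is strictly convex along a segment,
which handles products of different expanding exponentials. -/

theorem isClosed_carrier : IsClosed (EntireFunctions : Set C(ℂ, ℂ)) := by
  refine isClosed_of_closure_subset fun f hf => ?_
  obtain ⟨l, hl, hlf⟩ := mem_closure_iff_ultrafilter.1 hf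
  have h := ContinuousMap.tendsto_iff_tendstoLocallyUniformly.1
    (show Tendsto (fun g : C(ℂ, ℂ) => g) (l : Filter C(ℂ, ℂ)) (𝓝 f) from hlf)
  have h' := (tendstoLocallyUniformlyOn_univ.2 h).differentiableOn
    (by filter_upwards [hl] with g hg using Differentiable.differentiableOn hg) isOpen_univ
  exact differentiableOn_univ.1 h'

instance : IsTopologicalRing EntireFunctions :=
  inferInstanceAs (IsTopologicalRing EntireFunctions.toSubring)

instance : CompleteSpace EntireFunctions := isClosed_carrier.completeSpace_coe

instance : SecondCountableTopology EntireFunctions :=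
  inferInstanceAs (SecondCountableTopology (EntireFunctions : Set C(ℂ, ℂ)))

instance : BaireSpace EntireFunctions := by
  have : (uniformity EntireFunctions).IsCountablyGenerated :=
    inferInstanceAs (Filter.comap _ (uniformity C(ℂ, ℂ))).IsCountablyGenerated
  let := UniformSpace.pseudoMetricSpace EntireFunctions
  infer_instance

theorem tendsto_iff {ι : Type*} {l : Filter ι} {F : ι → EntireFunctions} {f : EntireFunctions} :
    Tendsto F l (𝓝 f) ↔
      ∀ R ε : ℝ, 0 < ε → ∀ᶠ i in l, ∀ z : ℂ, ‖z‖ ≤ R → ‖F i z - f z‖ < ε := by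
  rw [tendsto_subtype_rng, ContinuousMap.tendsto_iff_forall_isCompact_tendstoUniformlyOn]
  constructor
  · intro h R ε hε
    filter_upwards [Metric.tendstoUniformlyOn_iff.1
      (h (Metric.closedBall 0 R) (isCompact_closedBall _ _)) ε hε] with i hi z hz
    simpa [dist_eq_norm, norm_sub_rev] using hi z (by simpa using hz)
  · intro h K hK
    obtain ⟨R, hR⟩ := hK.isBounded.subset_closedBall 0
    refine Metric.tendstoUniformlyOn_iff.2 fun ε hε => ?_
    filter_upwards [h R ε hε] with i hi z hz
    simpa [dist_eq_norm, norm_sub_rev] using hi z (by simpa using hR hz)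

theorem continuous_eval (z : ℂ) : Continuous fun f : EntireFunctions => f z :=
  (ContinuousEvalConst.continuous_eval_const (F := C(ℂ, ℂ)) z).comp continuous_subtype_val

theorem ext_apply {f g : EntireFunctions} (h : ∀ z : ℂ, f z = g z) : f = g :=
  Subtype.ext (ContinuousMap.ext h)

theorem sum_apply {ι : Type*} (s : Finset ι) (g : ι → EntireFunctions) (z : ℂ) :
    (∑ i ∈ s, g i : EntireFunctions) z = ∑ i ∈ s, g i z := by
  classical
  induction s using Finset.induction_on with
  | empty => rfl
  | insert a s ha ih => rw [Finset.sum_insert ha, Finset.sum_insert ha, ← ih]; rfl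

theorem hasSum_apply {ι : Type*} {g : ι → EntireFunctions} {f : EntireFunctions}
    (h : HasSum g f) (z : ℂ) : HasSum (fun i => g i z) (f z) := by
  have := ((continuous_eval z).tendsto f).comp h
  simpa [HasSum, Function.comp_def, sum_apply] using this

theorem summable_of_bound {ι : Type*} {g : ι → EntireFunctions}
    (h : ∀ R : ℝ, ∃ b : ι → ℝ, Summable b ∧ ∀ i, ∀ z : ℂ, ‖z‖ ≤ R → ‖g i z‖ ≤ b i) :
    Summable g := by
  have hs : Summable fun i => (g i : C(ℂ, ℂ)) := by
    refine ContinuousMap.summable_of_locally_summable_norm fun K => ?_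
    obtain ⟨R, hR⟩ := K.isCompact.isBounded.subset_closedBall 0
    obtain ⟨b, hb, hgb⟩ := h (max R 0)
    refine Summable.of_norm_bounded (g := fun i => |b i|) hb.abs fun i => ?_
    rw [norm_norm]
    refine (ContinuousMap.norm_le _ (abs_nonneg _)).2 fun z => ?_
    refine (hgb i z ?_).trans (le_abs_self _)
    exact (by simpa using hR z.2 : ‖(z : ℂ)‖ ≤ R).trans (le_max_left _ _)
  obtain ⟨f, hf⟩ := hs
  have hmem : f ∈ (EntireFunctions : Set C(ℂ, ℂ)) :=
    isClosed_carrier.mem_of_tendsto hf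
      (Eventually.of_forall fun s => EntireFunctions.sum_mem fun i _ => (g i).2)
  refine ⟨⟨f, hmem⟩, ?_⟩
  refine (Topology.IsInducing.subtypeVal.tendsto_nhds_iff).2 ?_
  refine Tendsto.congr (fun s => ?_) hf
  simp

theorem D_pow_apply (n : ℕ) (f : EntireFunctions) (z : ℂ) :
    ((D ^ n) f : EntireFunctions) z = iteratedDeriv n f z := by
  induction n generalizing z with
  | zero => simp
  | succ n ih =>
    rw [pow_succ', iteratedDeriv_succ]
    change deriv ((D ^ n) f : EntireFunctions) z = _
    exact congrArg (fun g => deriv g z) (funext ih)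

/-! ### Consequences of subexponential growth -/

theorem norm_le_maxModulus (f : EntireFunctions) {z : ℂ} {r : ℝ} (hz : ‖z‖ ≤ r) :
    ‖f z‖ ≤ maxModulus f r := by
  refine le_csSup ?_ ⟨z, by simpa using hz, rfl⟩
  exact ((isCompact_closedBall 0 r).image (differentiable f).continuous.norm).bddAbove

theorem eventually_log_maxModulus_le {f : EntireFunctions} (hconst : ¬ IsConstant f)
    (hf : IsOfSubexponentialGrowth f) {ε : ℝ} (hε : 0 < ε) :
    ∀ᶠ r in atTop, Real.log (maxModulus f r) ≤ ε * r := by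
  rcases hf with h | ⟨-, h⟩
  · rw [growthOrder, if_neg hconst] at h
    obtain ⟨s, hs1, hs2⟩ := EReal.lt_iff_exists_real_btwn.1 h
    have hs2' : s < 1 := by exact_mod_cast hs2
    have hpow : ∀ᶠ r : ℝ in atTop, r ^ (s - 1) < ε := by
      have := tendsto_rpow_neg_atTop (y := 1 - s) (by linarith)
      filter_upwards [this.eventually_lt_const hε] with r hr
      simpa using hr
    filter_upwards [eventually_lt_of_limsup_lt hs1, hpow, eventually_gt_atTop 1] with r h1 h2 h3
    have h1' : Real.log (Real.log (maxModulus f r)) / Real.log r < s := by exact_mod_cast h1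
    -- The bound on the iterated logarithm says something about `log M(r)` only when the latter is
    -- positive.
    rcases le_or_gt (Real.log (maxModulus f r)) 0 with hl | hl
    · exact hl.trans (by positivity)
    · rw [div_lt_iff₀ (Real.log_pos h3)] at h1'
      have h0 : 0 < r := by linarith
      have : Real.log (maxModulus f r) < r ^ s := by
        rw [← Real.log_lt_log_iff hl (by positivity), Real.log_rpow h0]
        exact h1'
      refine this.le.trans ?_
      have e : r ^ s = r ^ (s - 1) * r := by
        rw [Real.rpow_sub_one h0.ne']; field_simp
      rw [e]
      exact mul_le_mul_of_nonneg_right h2.le h0.le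
  · rw [growthType] at h
    have h' := lt_of_le_of_lt h (show ((0 : ℝ) : EReal) < (ε : EReal) by exact_mod_cast hε)
    filter_upwards [eventually_lt_of_limsup_lt h', eventually_gt_atTop 0] with r h1 h0
    have h1' : r ^ (-(1 : ℝ)) * Real.log (maxModulus f r) < ε := by exact_mod_cast h1
    rw [Real.rpow_neg_one, inv_mul_lt_iff₀ h0] at h1'
    linarith

theorem exists_norm_le_exp {f : EntireFunctions} (hconst : ¬ IsConstant f)
    (hf : IsOfSubexponentialGrowth f) {ε : ℝ} (hε : 0 < ε) :
    ∃ K : ℝ, 0 < K ∧ ∀ z : ℂ, ‖f z‖ ≤ K * Real.exp (ε * ‖z‖) := by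
  obtain ⟨R, hR⟩ := eventually_atTop.1 (eventually_log_maxModulus_le hconst hf hε)
  refine ⟨Real.exp (ε * |R|), Real.exp_pos _, fun z => ?_⟩
  set r := |R| + ‖z‖
  have h := hR r ((le_abs_self R).trans (by simp [r]))
  rw [← Real.exp_add, ← mul_add]
  refine (norm_le_maxModulus f (show ‖z‖ ≤ r by simp [r])).trans ?_
  rcases le_or_gt (maxModulus f r) 0 with h0 | h0
  · exact h0.trans (Real.exp_pos _).le
  · exact (Real.log_le_iff_le_exp h0).1 h

theorem not_exponential {f : EntireFunctions} (hconst : ¬ IsConstant f)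
    (hf : IsOfSubexponentialGrowth f) (c : ℂ) : ¬ ∀ z : ℂ, f z = f 0 * Complex.exp (c * z) := by
  intro h
  have hc : c ≠ 0 := by
    rintro rfl
    exact hconst ⟨f 0, fun z => by rw [h z]; simp⟩
  have hf0 : f 0 ≠ 0 := fun h0 => hconst ⟨0, fun z => by rw [h z, h0, zero_mul]⟩
  have hcn : 0 < ‖c‖ := norm_pos_iff.2 hc
  obtain ⟨K, hK, hb⟩ := exists_norm_le_exp hconst hf (half_pos hcn)
  have key : ∀ t : ℝ, 0 ≤ t → ‖f 0‖ * Real.exp (t * (‖c‖ / 2)) ≤ K := by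
    intro t ht
    -- In the direction of the conjugate of `c` the exponent is real, so the exponential grows at
    -- the full rate `‖c‖`, twice the rate allowed by `hb`.
    have h1 := hb ((t : ℂ) * (starRingEnd ℂ c) / ‖c‖)
    have e1 : c * ((t : ℂ) * (starRingEnd ℂ c) / ‖c‖) = ((t * ‖c‖ : ℝ) : ℂ) := by
      have : c * (starRingEnd ℂ c) = ((‖c‖ : ℂ)) ^ 2 := Complex.mul_conj' c
      have hn : (‖c‖ : ℂ) ≠ 0 := by exact_mod_cast hcn.ne'
      push_cast
      field_simp
      linear_combination (t : ℂ) * this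
    have e2 : ‖(t : ℂ) * (starRingEnd ℂ c) / ‖c‖‖ = t := by
      simp [abs_of_nonneg ht, hcn.ne']
    rw [h, e1, norm_mul, Complex.norm_exp_ofReal, e2] at h1
    have e3 : Real.exp (t * ‖c‖) = Real.exp (t * (‖c‖ / 2)) * Real.exp (‖c‖ / 2 * t) := by
      rw [← Real.exp_add]; ring_nf
    rw [e3, ← mul_assoc] at h1
    exact le_of_mul_le_mul_right h1 (Real.exp_pos _)
  have ht : Tendsto (fun t : ℝ => ‖f 0‖ * Real.exp (t * (‖c‖ / 2))) atTop atTop :=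
    (Real.tendsto_exp_atTop.comp (tendsto_id.atTop_mul_const (half_pos hcn))).const_mul_atTop
      (norm_pos_iff.2 hf0)
  obtain ⟨t, h1, h2⟩ := ((ht.eventually_gt_atTop K).and (eventually_ge_atTop 0)).exists
  exact absurd (key t h2) (not_le.2 h1)

/-- Cauchy's estimate on the circle of radius `(n + 1) / δ` with `δ = ε / e`: there `f` is at most
`K e^(n+1)`, and `n! ≤ (n + 1)^n` absorbs the radius. Using `n + 1` keeps the radius positive at `n
= 0`. -/
theorem exists_norm_iteratedDeriv_le {f : EntireFunctions} (hconst : ¬ IsConstant f)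
    (hf : IsOfSubexponentialGrowth f) {ε : ℝ} (hε : 0 < ε) :
    ∃ K : ℝ, 0 < K ∧ ∀ n : ℕ, ‖iteratedDeriv n f 0‖ ≤ K * ε ^ n := by
  have he := Real.exp_pos 1
  set δ := ε / Real.exp 1 with hδ
  have hδ0 : 0 < δ := by positivity
  obtain ⟨K, hK, hb⟩ := exists_norm_le_exp hconst hf hδ0
  refine ⟨K * Real.exp 1, by positivity, fun n => ?_⟩
  have hR : 0 < ((n : ℝ) + 1) / δ := by positivity
  have h1 := Complex.norm_iteratedDeriv_le_of_forall_mem_sphere_norm_le (c := 0)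
    (C := K * Real.exp 1 ^ (n + 1)) n hR (differentiable f).diffContOnCl fun z hz => by
      have h := hb z
      rw [mem_sphere_zero_iff_norm] at hz
      rw [hz, mul_div_cancel₀ _ hδ0.ne'] at h
      rw [← Real.exp_nat_mul]
      push_cast
      simpa using h
  refine h1.trans ?_
  have hfac : (n.factorial : ℝ) ≤ ((n : ℝ) + 1) ^ n := by
    have : n.factorial ≤ (n + 1) ^ n :=
      (Nat.factorial_le_pow n).trans (Nat.pow_le_pow_left (Nat.le_succ n) n)
    exact_mod_cast this
  have hεδ : ε = δ * Real.exp 1 := by rw [hδ]; field_simp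
  rw [div_pow, div_div_eq_mul_div, div_le_iff₀ (by positivity), hεδ, mul_pow, pow_succ]
  calc _ = n.factorial * (K * (Real.exp 1 ^ n * Real.exp 1) * δ ^ n) := by ring
    _ ≤ ((n : ℝ) + 1) ^ n * (K * (Real.exp 1 ^ n * Real.exp 1) * δ ^ n) := by gcongr
    _ = _ := by ring

/-! ### The operator `Φ(D)` -/

theorem exists_norm_le (f : EntireFunctions) (R : ℝ) :
    ∃ C : ℝ, 0 ≤ C ∧ ∀ z : ℂ, ‖z‖ ≤ R → ‖f z‖ ≤ C :=
  ⟨max (maxModulus f R) 0, le_max_right _ _, fun _ hz =>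
    (norm_le_maxModulus f hz).trans (le_max_left _ _)⟩

/-- Cauchy's estimate on the unit circle about `z` costs a factor `n!`, which the denominator of the
Taylor coefficient cancels. The geometric decay gives both convergence and continuity of `Φ(D)`. -/
theorem norm_coeff_smul_D_pow_le {Φ : EntireFunctions} {K : ℝ} (hK : 0 < K)
    (hΦ : ∀ n : ℕ, ‖iteratedDeriv n Φ 0‖ ≤ K * (1 / 2) ^ n) {f : EntireFunctions} {R C : ℝ}
    (hf : ∀ z : ℂ, ‖z‖ ≤ R + 1 → ‖f z‖ ≤ C) (n : ℕ) {z : ℂ} (hz : ‖z‖ ≤ R) :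
    ‖(coeff Φ n • (D ^ n) f : EntireFunctions) z‖ ≤ K * C * (1 / 2) ^ n := by
  have hC : 0 ≤ C := (norm_nonneg _).trans (hf z (by linarith))
  change ‖coeff Φ n * ((D ^ n) f : EntireFunctions) z‖ ≤ _
  have h1 := Complex.norm_iteratedDeriv_le_of_forall_mem_sphere_norm_le (c := z) (C := C) n
    one_pos (differentiable f).diffContOnCl fun w hw => hf w (by
      rw [mem_sphere_iff_norm] at hw
      calc ‖w‖ = ‖z + (w - z)‖ := by ring_nf
        _ ≤ ‖z‖ + ‖w - z‖ := norm_add_le _ _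
        _ ≤ R + 1 := by linarith)
  have hn : (0 : ℝ) < n.factorial := by exact_mod_cast n.factorial_pos
  rw [D_pow_apply, norm_mul, coeff, norm_div, Complex.norm_natCast]
  calc _ ≤ K * (1 / 2) ^ n / n.factorial * (n.factorial * C / 1 ^ n) := by
        gcongr
        exact hΦ n
    _ = _ := by field_simp; simp

theorem summable_symbol {Φ : EntireFunctions} {K : ℝ} (hK : 0 < K)
    (hΦ : ∀ n : ℕ, ‖iteratedDeriv n Φ 0‖ ≤ K * (1 / 2) ^ n) (f : EntireFunctions) :
    Summable fun n : ℕ => coeff Φ n • (D ^ n) f := by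
  refine summable_of_bound fun R => ?_
  obtain ⟨C, -, hC⟩ := exists_norm_le f (R + 1)
  exact ⟨fun n => K * C * (1 / 2) ^ n, summable_geometric_two.mul_left _,
    fun n z hz => norm_coeff_smul_D_pow_le hK hΦ hC n hz⟩

theorem exists_isSymbolOperator {Φ : EntireFunctions} {K : ℝ} (hK : 0 < K)
    (hΦ : ∀ n : ℕ, ‖iteratedDeriv n Φ 0‖ ≤ K * (1 / 2) ^ n) :
    ∃ T : EntireFunctions →L[ℂ] EntireFunctions, IsSymbolOperator Φ T := by
  have hs := summable_symbol hK hΦ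
  let T : EntireFunctions →ₗ[ℂ] EntireFunctions :=
    { toFun := fun f => ∑' n : ℕ, coeff Φ n • (D ^ n) f
      map_add' := fun f g => by
        rw [← (hs f).tsum_add (hs g)]
        simp [smul_add]
      map_smul' := fun c f => by
        simp only [RingHom.id_apply]
        rw [← (hs f).tsum_const_smul c]
        simp [smul_comm c] }
  have hT : ∀ f, HasSum (fun n : ℕ => coeff Φ n • (D ^ n) f) (T f) := fun f => (hs f).hasSum
  have hbound : ∀ (f : EntireFunctions) (R C : ℝ), (∀ z : ℂ, ‖z‖ ≤ R + 1 → ‖f z‖ ≤ C) →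
      ∀ z : ℂ, ‖z‖ ≤ R → ‖T f z‖ ≤ K * C * 2 := fun f R C hC z hz => by
    rw [← (hasSum_apply (hT f) z).tsum_eq]
    exact tsum_of_norm_bounded (hasSum_geometric_two.mul_left (K * C))
      fun n => norm_coeff_smul_D_pow_le hK hΦ hC n hz
  refine ⟨⟨T, continuous_iff_continuousAt.2 fun f₀ => tendsto_iff.2 fun R ε hε => ?_⟩, hT⟩
  have h := tendsto_iff.1 (tendsto_id (x := 𝓝 f₀)) (R + 1) (ε / (4 * K)) (by positivity)
  filter_upwards [h] with f hf z hz
  have h1 := hbound (f - f₀) R (ε / (4 * K)) (fun w hw => (hf w hw).le) z hz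
  have e : K * (ε / (4 * K)) * 2 = ε / 2 := by field_simp; norm_num
  have h2 : T f = T (f - f₀) + T f₀ := by
    rw [← map_add]
    exact congrArg T (ext_apply fun w => (sub_add_cancel (f w) (f₀ w)).symm)
  have h3 : T f z - T f₀ z = T (f - f₀) z := by
    rw [h2]
    exact add_sub_cancel_right (T (f - f₀) z) (T f₀ z)
  change ‖T f z - T f₀ z‖ < ε
  rw [h3]
  exact (h1.trans_eq e).trans_lt (half_lt_self hε)

/-! ### Exponentials as eigenvectors -/

/-- The entire function `z ↦ exp (c z)`. -/
noncomputable def expFun (c : ℂ) : EntireFunctions :=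
  ⟨⟨fun z => Complex.exp (c * z), by fun_prop⟩,
    show Differentiable ℂ fun z => Complex.exp (c * z) by fun_prop⟩

theorem expFun_apply (c z : ℂ) : expFun c z = Complex.exp (c * z) := rfl

theorem prod_expFun {ι : Type*} (s : Finset ι) (c : ι → ℂ) :
    ∏ i ∈ s, expFun (c i) = expFun (∑ i ∈ s, c i) := by
  classical
  induction s using Finset.induction_on with
  | empty =>
    refine ext_apply fun z => ?_
    simp [expFun_apply]
  | insert a s ha ih =>
    rw [Finset.prod_insert ha, Finset.sum_insert ha, ih]
    refine ext_apply fun z => ?_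
    change expFun _ z * expFun _ z = _
    simp only [expFun_apply, add_mul, Complex.exp_add]

theorem D_pow_expFun (n : ℕ) (c : ℂ) : (D ^ n) (expFun c) = c ^ n • expFun c := by
  have h1 : D (expFun c) = c • expFun c := by
    refine ext_apply fun z => ?_
    change deriv (fun z => Complex.exp (c * z)) z = c * Complex.exp (c * z)
    have h : HasDerivAt (fun z => Complex.exp (c * z)) (Complex.exp (c * z) * (c * 1)) z :=
      ((hasDerivAt_id z).const_mul c).cexp
    rw [h.deriv]; ring
  induction n with
  | zero => simp
  | succ n ih =>
    rw [pow_succ', Module.End.mul_apply, ih, map_smul, h1, smul_smul, pow_succ]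

theorem IsSymbolOperator.apply_expFun {Φ : EntireFunctions}
    {T : EntireFunctions →L[ℂ] EntireFunctions} (hT : IsSymbolOperator Φ T) (c : ℂ) :
    T (expFun c) = Φ c • expFun c := by
  refine ext_apply fun z => (hasSum_apply (hT (expFun c)) z).unique ?_
  have h := (Complex.hasSum_taylorSeries_of_entire (differentiable Φ) 0 c).mul_right (expFun c z)
  change HasSum _ (Φ c * expFun c z)
  refine (show (fun n => (coeff Φ n • (D ^ n) (expFun c) : EntireFunctions) z) = _ from
    funext fun n => ?_) ▸ h
  rw [D_pow_expFun]
  change coeff Φ n * (c ^ n * expFun c z) = _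
  simp only [coeff, smul_eq_mul, sub_zero]
  ring

theorem IsSymbolOperator.pow_apply_expFun {Φ : EntireFunctions}
    {T : EntireFunctions →L[ℂ] EntireFunctions} (hT : IsSymbolOperator Φ T) (c : ℂ) (N : ℕ) :
    (T ^ N) (expFun c) = Φ c ^ N • expFun c := by
  induction N with
  | zero => simp
  | succ N ih =>
    rw [pow_succ', mul_apply_eq_comp, ih, map_smul, hT.apply_expFun, smul_smul,
      pow_succ]

/-! ### Density of spans of exponentials -/

/-- The entire function `z ↦ z ^ k * exp (a z)`. -/
noncomputable def monomialExp (a : ℂ) (k : ℕ) : EntireFunctions :=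
  ⟨⟨fun z => z ^ k * Complex.exp (a * z), by fun_prop⟩,
    show Differentiable ℂ fun z => z ^ k * Complex.exp (a * z) by fun_prop⟩

theorem monomialExp_apply (a : ℂ) (k : ℕ) (z : ℂ) :
    monomialExp a k z = z ^ k * Complex.exp (a * z) := rfl

/-- Multiply the Taylor series of `f(z) e^{-az}` by `e^{az}`. -/
theorem hasSum_monomialExp (f : EntireFunctions) (a : ℂ) :
    HasSum (fun n => coeff (f * expFun (-a)) n • monomialExp a n) f := by
  set g := f * expFun (-a)
  have htaylor : ∀ z : ℂ, HasSum (fun n => coeff g n * z ^ n) (g z) := fun z => by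
    have h := Complex.hasSum_taylorSeries_of_entire (differentiable g) 0 z
    refine (show (fun n => coeff g n * z ^ n) = _ from funext fun n => ?_) ▸ h
    simp only [coeff, smul_eq_mul, sub_zero]
    ring
  have hs : Summable fun n => coeff g n • monomialExp a n := by
    refine summable_of_bound fun R => ⟨fun n => ‖coeff g n * ((|R| : ℝ) : ℂ) ^ n‖ *
      Real.exp (‖a‖ * |R|), (htaylor _).summable.norm.mul_right _, fun n z hz => ?_⟩
    have hz' : ‖z‖ ≤ |R| := hz.trans (le_abs_self R)
    change ‖coeff g n * (z ^ n * Complex.exp (a * z))‖ ≤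
      ‖coeff g n * ((|R| : ℝ) : ℂ) ^ n‖ * Real.exp (‖a‖ * |R|)
    rw [← mul_assoc, norm_mul, norm_mul, norm_mul, norm_pow, norm_pow, Complex.norm_real,
      Real.norm_eq_abs, abs_abs]
    have : ‖Complex.exp (a * z)‖ ≤ Real.exp (‖a‖ * |R|) :=
      (Complex.norm_exp_le_exp_norm _).trans
        (Real.exp_le_exp.2 (by rw [norm_mul]; gcongr))
    gcongr
  obtain ⟨F, hF⟩ := hs
  have hFf : F = f := by
    refine ext_apply fun z => ?_
    have h := (htaylor z).mul_right (Complex.exp (a * z))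
    have e : g z * Complex.exp (a * z) = f z := by
      change f z * Complex.exp (-a * z) * Complex.exp (a * z) = f z
      rw [mul_assoc, ← Complex.exp_add]
      simp
    rw [e] at h
    refine (hasSum_apply hF z).unique ?_
    refine (show (fun n => (coeff g n • monomialExp a n : EntireFunctions) z) = _ from
      funext fun n => ?_) ▸ h
    change coeff g n * (z ^ n * Complex.exp (a * z)) = _
    ring
  exact hFf ▸ hF

theorem sub_apply (f g : EntireFunctions) (z : ℂ) : (f - g : EntireFunctions) z = f z - g z := rfl

theorem smul_apply (c : ℂ) (f : EntireFunctions) (z : ℂ) :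
    (c • f : EntireFunctions) z = c * f z := rfl

theorem sub_mem_submodule {M : Submodule ℂ EntireFunctions} {f g : EntireFunctions} (hf : f ∈ M)
    (hg : g ∈ M) : f - g ∈ M := by
  have e : f - g = f + (-1 : ℂ) • g := ext_apply fun z => by
    change f z - g z = f z + -1 * g z
    ring
  exact e ▸ M.add_mem hf (M.smul_mem _ hg)

/-- The function `z^k e^{az}` is the `k`-th derivative of `e^{cz}` in the frequency `c` at `c = a`.
It is recovered by induction as the limit, as `t → 0+`, of the Taylor remainder of order `k` in
`tw`, multiplied by `k! / (tw)^k`. -/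
theorem monomialExp_mem_of_isClosed {M : Submodule ℂ EntireFunctions}
    (hM : IsClosed (M : Set EntireFunctions)) {a w : ℂ} (hw : w ≠ 0) {δ : ℝ} (hδ : 0 < δ)
    (h : ∀ t : ℝ, 0 < t → t < δ → expFun (a + t * w) ∈ M) (k : ℕ) : monomialExp a k ∈ M := by
  induction k using Nat.strong_induction_on with
  | _ k ih =>
  let F : ℝ → EntireFunctions := fun t => (k.factorial / (t * w) ^ k : ℂ) •
    (expFun (a + t * w) - ∑ i ∈ Finset.range k, ((t * w) ^ i / i.factorial : ℂ) • monomialExp a i)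
  refine hM.mem_of_tendsto (f := F) (b := 𝓝[>] (0 : ℝ)) ?_ ?_
  · refine tendsto_iff.2 fun R ε hε => ?_
    set C := Real.exp (‖a‖ * |R|) *
      (k.factorial * (‖w‖ * |R| ^ (k + 1) * Real.exp (‖w‖ * |R|))) with hC
    have hC0 : 0 ≤ C := by positivity
    have hlim : Tendsto (fun t : ℝ => C * t) (𝓝[>] 0) (𝓝 0) :=
      ((continuous_const.mul continuous_id).tendsto' 0 0 (by simp)).mono_left nhdsWithin_le_nhds
    filter_upwards [hlim.eventually_lt_const hε, self_mem_nhdsWithin,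
      nhdsWithin_le_nhds (eventually_lt_nhds (zero_lt_one (α := ℝ)))] with t ht ht0 ht1 z hz
    rw [Set.mem_Ioi] at ht0
    have hz' : ‖z‖ ≤ |R| := hz.trans (le_abs_self R)
    have htw : (t * w : ℂ) ≠ 0 := mul_ne_zero (by exact_mod_cast ht0.ne') hw
    have hk : (k.factorial : ℂ) ≠ 0 := by exact_mod_cast k.factorial_ne_zero
    have e : F t z - monomialExp a k z = Complex.exp (a * z) * (k.factorial / (t * w) ^ k *
        (Complex.exp (t * w * z) -
          ∑ i ∈ Finset.range (k + 1), (t * w * z) ^ i / (i.factorial : ℂ))) := by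
      simp only [F, smul_apply, sub_apply, sum_apply, monomialExp_apply, expFun_apply]
      rw [Finset.sum_range_succ, add_mul, Complex.exp_add]
      have : ∑ i ∈ Finset.range k, (t * w : ℂ) ^ i / i.factorial * (z ^ i * Complex.exp (a * z)) =
          Complex.exp (a * z) *
            ∑ i ∈ Finset.range k, (t * w * z) ^ i / (i.factorial : ℂ) := by
        rw [Finset.mul_sum]
        exact Finset.sum_congr rfl fun i _ => by rw [mul_pow]; ring
      rw [this, mul_pow _ z]
      field_simp
      ring
    rw [e]
    refine lt_of_le_of_lt ?_ ht
    have hnorm : ‖(t * w : ℂ)‖ = t * ‖w‖ := by simp [abs_of_pos ht0]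
    have hwn : 0 < ‖w‖ := norm_pos_iff.2 hw
    have h1 := Complex.norm_exp_sub_sum_le_norm_mul_exp (t * w * z) (k + 1)
    have h2 : ‖(t * w * z : ℂ)‖ ≤ t * (‖w‖ * |R|) := by
      rw [norm_mul, hnorm, mul_assoc]; gcongr
    have h3 : Real.exp ‖(t * w * z : ℂ)‖ ≤ Real.exp (‖w‖ * |R|) := by
      refine Real.exp_le_exp.2 (h2.trans ?_)
      exact mul_le_of_le_one_left (by positivity) ht1.le
    have h4 : ‖Complex.exp (a * z)‖ ≤ Real.exp (‖a‖ * |R|) :=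
      (Complex.norm_exp_le_exp_norm _).trans
        (Real.exp_le_exp.2 (by rw [norm_mul]; gcongr))
    calc _ ≤ Real.exp (‖a‖ * |R|) * (k.factorial / (t * ‖w‖) ^ k *
          ((t * (‖w‖ * |R|)) ^ (k + 1) * Real.exp (‖w‖ * |R|))) := by
          rw [norm_mul, norm_mul, norm_div, norm_pow, hnorm, Complex.norm_natCast]
          gcongr
          exact h1.trans (by gcongr)
      _ = C * t := by
          rw [hC]
          field_simp
          ring
  · filter_upwards [self_mem_nhdsWithin, nhdsWithin_le_nhds (eventually_lt_nhds hδ)] with t h0 h1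
    exact M.smul_mem _ (sub_mem_submodule (h t h0 h1)
      (M.sum_mem fun i hi => M.smul_mem _ (ih i (Finset.mem_range.1 hi))))

/-- Exponentials with frequencies in a nondegenerate segment span a dense subspace. -/
theorem dense_span_expFun (a : ℂ) {w : ℂ} (hw : w ≠ 0) {δ : ℝ} (hδ : 0 < δ) :
    Dense (Submodule.span ℂ ((fun t : ℝ => expFun (a + t * w)) '' Set.Ioo 0 δ) :
      Set EntireFunctions) := by
  set M := (Submodule.span ℂ
    ((fun t : ℝ => expFun (a + t * w)) '' Set.Ioo 0 δ)).topologicalClosure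
  have hM : IsClosed (M : Set EntireFunctions) := Submodule.isClosed_topologicalClosure _
  have h : ∀ t : ℝ, 0 < t → t < δ → expFun (a + t * w) ∈ M := fun t h0 h1 =>
    Submodule.le_topologicalClosure _ (Submodule.subset_span ⟨t, ⟨h0, h1⟩, rfl⟩)
  intro f
  change f ∈ M
  exact hM.mem_of_tendsto (hasSum_monomialExp f a) (Eventually.of_forall fun s =>
    M.sum_mem fun n _ => M.smul_mem _ (monomialExp_mem_of_isClosed hM hw hδ h n))

end EntireFunctions

/-! ### The Baire category criterion -/

/-- The non-unital algebra `{P(u) : P(0) = 0}` generated by `u`. -/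
def polynomialAlgebra {X : Type*} [CommRing X] [Algebra ℂ X] (u : X) : NonUnitalSubalgebra ℂ X where
  carrier := {x | ∃ P : Polynomial ℂ, P.coeff 0 = 0 ∧ Polynomial.aeval u P = x}
  add_mem' := by
    rintro _ _ ⟨P, hP, rfl⟩ ⟨Q, hQ, rfl⟩
    exact ⟨P + Q, by simp [hP, hQ], by simp⟩
  zero_mem' := ⟨0, by simp, by simp⟩
  mul_mem' := by
    rintro _ _ ⟨P, hP, rfl⟩ ⟨Q, hQ, rfl⟩
    exact ⟨P * Q, by simp [Polynomial.mul_coeff_zero, hP], by simp⟩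
  smul_mem' := by
    rintro c _ ⟨P, hP, rfl⟩
    exact ⟨c • P, by simp [hP], by simp⟩

/-- For a target `o`, steer `T^N (u^m)` close to `o` divided by the leading coefficient while the
same `N` makes all lower powers small. -/
theorem isHypercyclicVector_aeval {X : Type*} [CommRing X] [Algebra ℂ X] [TopologicalSpace X]
    [IsTopologicalRing X] [ContinuousSMul ℂ X] {T : X →L[ℂ] X} {u : X}
    (hu : ∀ m : ℕ, 1 ≤ m → ∀ V W : Set X, IsOpen V → V.Nonempty → IsOpen W → (0 : X) ∈ W →
      ∃ N : ℕ, (T ^ N) (u ^ m) ∈ V ∧ ∀ n, 1 ≤ n → n < m → (T ^ N) (u ^ n) ∈ W)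
    {P : Polynomial ℂ} (hP : P.coeff 0 = 0) (hP0 : P ≠ 0) :
    IsHypercyclicVector T (Polynomial.aeval u P) := by
  set m := P.natDegree with hm
  have hlc : P.coeff m ≠ 0 := by simpa [hm] using hP0
  have hm1 : 1 ≤ m := by
    rcases Nat.eq_zero_or_pos m with h | h
    · rw [h] at hlc; exact absurd hP hlc
    · exact h
  have hexp : ∀ N : ℕ, (T ^ N) (Polynomial.aeval u P) = P.coeff m • (T ^ N) (u ^ m) +
      ∑ n ∈ Finset.Ico 1 m, P.coeff n • (T ^ N) (u ^ n) := by
    intro N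
    rw [Polynomial.aeval_eq_sum_range, ← hm, Finset.sum_range_succ, Finset.range_eq_Ico,
      Finset.sum_eq_sum_Ico_succ_bot (by omega), hP]
    simp [map_add, map_sum, add_comm]
  refine dense_iff_inter_open.2 fun O hO ⟨o, ho⟩ => ?_
  set F : X × (ℕ → X) → X := fun p =>
    P.coeff m • p.1 + ∑ n ∈ Finset.Ico 1 m, P.coeff n • p.2 n with hF
  have hFc : Continuous F := by
    refine (continuous_const.smul continuous_fst).add
      (continuous_finsetSum _ fun n _ => ?_)
    exact continuous_const.smul ((continuous_apply n).comp continuous_snd)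
  have hF0 : F ((P.coeff m)⁻¹ • o, 0) = o := by simp [hF, smul_smul, mul_inv_cancel₀ hlc]
  have hnb : F ⁻¹' O ∈ 𝓝 (((P.coeff m)⁻¹ • o, 0) : X × (ℕ → X)) :=
    (hO.preimage hFc).mem_nhds (by rw [Set.mem_preimage, hF0]; exact ho)
  obtain ⟨V, hV, W', hW', hVW⟩ := mem_nhds_prod_iff.1 hnb
  obtain ⟨V₁, hV₁, hV₁o, hV₁m⟩ := mem_nhds_iff.1 hV
  rw [nhds_pi, Filter.mem_pi] at hW'
  obtain ⟨I, hI, t, ht, hIt⟩ := hW'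
  have hW : (⋂ i ∈ I, t i) ∈ 𝓝 (0 : X) := (Filter.biInter_mem hI).2 fun i _ => ht i
  obtain ⟨W, hWs, hWo, hW0⟩ := mem_nhds_iff.1 hW
  obtain ⟨N, hN, hNW⟩ := hu m hm1 V₁ W hV₁o ⟨_, hV₁m⟩ hWo hW0
  refine ⟨_, ?_, ⟨N, rfl⟩⟩
  -- The family is set to `0` outside `1 ≤ n < m`, since the basic neighbourhood may also restrict
  -- those coordinates.
  have key := @hVW ((T ^ N) (u ^ m), fun n => if n ∈ Finset.Ico 1 m then (T ^ N) (u ^ n) else 0)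
    ⟨hV₁ hN, hIt fun i hi => ?_⟩
  · change (T ^ N) (Polynomial.aeval u P) ∈ O
    rw [hexp]
    have e : F ((T ^ N) (u ^ m), fun n => if n ∈ Finset.Ico 1 m then (T ^ N) (u ^ n) else 0) =
        P.coeff m • (T ^ N) (u ^ m) + ∑ n ∈ Finset.Ico 1 m, P.coeff n • (T ^ N) (u ^ n) := by
      simp only [hF]
      congr 1
      exact Finset.sum_congr rfl fun n hn => by simp [hn]
    rw [← e]
    exact key
  · have hmem : ∀ w ∈ W, w ∈ t i := fun w hw => Set.mem_iInter₂.1 (hWs hw) i hi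
    by_cases h : i ∈ Finset.Ico 1 m
    · simp only [h, if_true]
      rw [Finset.mem_Ico] at h
      exact hmem _ (hNW i h.1 h.2)
    · simp only [h, if_false]
      exact hmem _ hW0

/-- A Baire category criterion for the existence of a hypercyclic algebra. -/
theorem exists_isHypercyclicAlgebra {X : Type*} [CommRing X] [Algebra ℂ X] [TopologicalSpace X]
    [IsTopologicalRing X] [ContinuousSMul ℂ X] [BaireSpace X] [SecondCountableTopology X]
    [T1Space X] [Nontrivial X] {T : X →L[ℂ] X}
    (H : ∀ m : ℕ, 1 ≤ m → ∀ U V W : Set X, IsOpen U → U.Nonempty → IsOpen V → V.Nonempty →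
      IsOpen W → (0 : X) ∈ W →
      ∃ u ∈ U, ∃ N : ℕ, (T ^ N) (u ^ m) ∈ V ∧ ∀ n, 1 ≤ n → n < m → (T ^ N) (u ^ n) ∈ W) :
    ∃ A : NonUnitalSubalgebra ℂ X, IsHypercyclicAlgebra T A := by
  classical
  set B := TopologicalSpace.countableBasis X
  have hB := TopologicalSpace.isBasis_countableBasis X
  let J := {p : ℕ × B × B // 1 ≤ p.1 ∧ (p.2.1 : Set X).Nonempty ∧ (0 : X) ∈ (p.2.2 : Set X)}
  have : Countable B := (TopologicalSpace.countable_countableBasis X).to_subtype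
  have : Countable J := inferInstance
  let G : J → Set X := fun p => ⋃ N : ℕ, {u | (T ^ N) (u ^ p.1.1) ∈ (p.1.2.1 : Set X)} ∩
    ⋂ n ∈ Finset.Ico 1 p.1.1, {u | (T ^ N) (u ^ n) ∈ (p.1.2.2 : Set X)}
  have hcont : ∀ N n : ℕ, Continuous fun u : X => (T ^ N) (u ^ n) := fun N n =>
    (T ^ N).continuous.comp (continuous_pow n)
  have hGo : ∀ p, IsOpen (G p) := fun p => isOpen_iUnion fun N =>
    ((hB.isOpen p.1.2.1.2).preimage (hcont N _)).inter
      (isOpen_biInter_finset fun n _ => (hB.isOpen p.1.2.2.2).preimage (hcont N n))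
  have hGd : ∀ p, Dense (G p) := by
    refine fun p => dense_iff_inter_open.2 fun U hU hUn => ?_
    obtain ⟨u, huU, N, h1, h2⟩ := H p.1.1 p.2.1 U _ _ hU hUn (hB.isOpen p.1.2.1.2) p.2.2.1
      (hB.isOpen p.1.2.2.2) p.2.2.2
    refine ⟨u, huU, Set.mem_iUnion.2 ⟨N, h1, Set.mem_iInter₂.2 fun n hn => ?_⟩⟩
    rw [Finset.mem_Ico] at hn
    exact h2 n hn.1 hn.2
  obtain ⟨u, hu⟩ := (dense_iInter_of_isOpen hGo hGd).nonempty
  have hu' : ∀ m : ℕ, 1 ≤ m → ∀ V W : Set X, IsOpen V → V.Nonempty → IsOpen W → (0 : X) ∈ W →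
      ∃ N : ℕ, (T ^ N) (u ^ m) ∈ V ∧ ∀ n, 1 ≤ n → n < m → (T ^ N) (u ^ n) ∈ W := by
    intro m hm V W hV ⟨v, hv⟩ hW hW0
    obtain ⟨V', hV'B, hvV', hV'⟩ := hB.exists_subset_of_mem_open hv hV
    obtain ⟨W', hW'B, hW'0, hW'⟩ := hB.exists_subset_of_mem_open hW0 hW
    have := Set.mem_iInter.1 hu ⟨(m, ⟨V', hV'B⟩, ⟨W', hW'B⟩), hm, ⟨v, hvV'⟩, hW'0⟩
    obtain ⟨N, h1, h2⟩ := Set.mem_iUnion.1 this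
    exact ⟨N, hV' h1, fun n hn hnm =>
      hW' (Set.mem_iInter₂.1 h2 n (Finset.mem_Ico.2 ⟨hn, hnm⟩))⟩
  refine ⟨polynomialAlgebra u, fun hbot => ?_, ?_⟩
  · have hmem : u ∈ polynomialAlgebra u := ⟨Polynomial.X, by simp, by simp⟩
    rw [hbot, NonUnitalAlgebra.mem_bot] at hmem
    -- The orbit of `u` meets the complement of `0`, so `u ≠ 0` and the algebra is not trivial.
    obtain ⟨N, hN, -⟩ := hu' 1 le_rfl {0}ᶜ Set.univ isOpen_compl_singleton
      ((exists_ne (0 : X)).imp fun _ h => h) isOpen_univ trivial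
    simp [hmem] at hN
  · rintro _ ⟨P, hP, rfl⟩ hne
    exact isHypercyclicVector_aeval hu' hP (by rintro rfl; simp at hne)

/-! ### Local geometry of `|Φ|` at the origin -/

/-- Multiplying a solution `w` by the `q`-th roots of unity gives other solutions. Since `q ≥ 2`
these roots sum to zero, so the real parts of `c w` cannot all be negative. -/
theorem exists_pow_mul_eq_one_re_nonneg (c d : ℂ) (hd : d ≠ 0) {q : ℕ} (hq : 2 ≤ q) :
    ∃ w : ℂ, w ^ q * d = 1 ∧ 0 ≤ (c * w).re := by
  obtain ⟨w, hw⟩ := IsAlgClosed.exists_pow_nat_eq d⁻¹ (show 0 < q by omega)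
  have hζ := Complex.isPrimitiveRoot_exp q (by omega)
  set ζ := Complex.exp (2 * Real.pi * Complex.I / q)
  have hsum : ∑ i ∈ Finset.range q, (c * (w * ζ ^ i)).re = 0 := by
    rw [← Complex.re_sum, ← Finset.mul_sum, ← Finset.mul_sum, hζ.geom_sum_eq_zero (by omega)]
    simp
  obtain ⟨i, -, hi⟩ := Finset.exists_le_of_sum_le (s := Finset.range q) (f := fun _ => (0 : ℝ))
    ⟨0, Finset.mem_range.2 (by omega)⟩ (by rw [hsum]; simp)
  refine ⟨w * ζ ^ i, ?_, hi⟩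
  rw [mul_pow, hw, ← pow_mul, mul_comm i, pow_mul, hζ.pow_eq_one, one_pow, mul_one,
    inv_mul_cancel₀ hd]

/-- Near a zero of a holomorphic function that is not affine, the function splits into its linear
part and a remainder of exact order `q ≥ 2`. -/
theorem exists_eq_linear_add_pow_mul {L : ℂ → ℂ} (hL : AnalyticAt ℂ L 0) (hL0 : L 0 = 0)
    (hne : ∀ c : ℂ, ¬ ∀ᶠ z in 𝓝 0, L z = c * z) :
    ∃ (c : ℂ) (q : ℕ) (ψ : ℂ → ℂ), 2 ≤ q ∧ AnalyticAt ℂ ψ 0 ∧ ψ 0 ≠ 0 ∧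
      ∀ᶠ z in 𝓝 0, L z = c * z + z ^ q * ψ z := by
  set c := deriv L 0
  have hF : AnalyticAt ℂ (fun z => L z - c * z) 0 := by fun_prop
  obtain ⟨q, ψ, hψ, hψ0, h⟩ := hF.exists_eventuallyEq_pow_smul_nonzero_iff.2
    fun h => hne c (h.mono fun z hz => sub_eq_zero.1 hz)
  simp only [sub_zero, smul_eq_mul] at h
  refine ⟨c, q, ψ, ?_, hψ, hψ0, h.mono fun z hz => by rw [← hz]; ring⟩
  -- Order `0` contradicts `L 0 = 0`; order `1` contradicts the removal of the derivative `c`.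
  by_contra hq
  have hq' : q = 0 ∨ q = 1 := by omega
  rcases hq' with rfl | rfl
  · have := h.self_of_nhds
    simp [hL0] at this
    exact hψ0 this.symm
  · have h1 : HasDerivAt (fun z => L z - c * z) (c - c * 1) 0 :=
      hL.differentiableAt.hasDerivAt.sub ((hasDerivAt_id 0).const_mul c)
    have h2 : HasDerivAt (fun z => z ^ 1 * ψ z) (((1 : ℕ) : ℂ) * 0 ^ (1 - 1) * 1 * ψ 0 +
        0 ^ 1 * deriv ψ 0) 0 :=
      ((hasDerivAt_id (0 : ℂ)).pow 1).mul hψ.differentiableAt.hasDerivAt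
    have := (h1.congr_of_eventuallyEq (h.mono fun z hz => hz.symm)).unique h2
    simp at this
    exact hψ0 this.symm

theorem eventually_deriv_deriv_ne_zero {L : ℂ → ℂ} (hL : AnalyticAt ℂ L 0) (hL0 : L 0 = 0)
    (hne : ∀ c : ℂ, ¬ ∀ᶠ z in 𝓝 0, L z = c * z) :
    ∀ᶠ z in 𝓝[≠] (0 : ℂ), deriv (deriv L) z ≠ 0 := by
  refine hL.deriv.deriv.eventually_eq_zero_or_eventually_ne_zero.resolve_left fun h => ?_
  obtain ⟨r, hr, hball⟩ := Metric.eventually_nhds_iff_ball.1 (h.and hL.eventually_analyticAt)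
  have h0 : (0 : ℂ) ∈ Metric.ball (0 : ℂ) r := Metric.mem_ball_self hr
  have hconst : ∀ z ∈ Metric.ball (0 : ℂ) r, deriv L z = deriv L 0 := fun z hz =>
    Metric.isOpen_ball.is_const_of_deriv_eq_zero (convex_ball _ _).isPreconnected
      (fun w hw => (hball w hw).2.deriv.differentiableAt.differentiableWithinAt)
      (fun w hw => (hball w hw).1) hz h0
  have hconst' : ∀ z ∈ Metric.ball (0 : ℂ) r, L z - deriv L 0 * z = L 0 - deriv L 0 * 0 :=
    fun z hz => Metric.isOpen_ball.is_const_of_deriv_eq_zero (f := fun z => L z - deriv L 0 * z)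
      (convex_ball _ _).isPreconnected
      (fun w hw => ((hball w hw).2.differentiableAt.sub (by fun_prop)).differentiableWithinAt)
      (fun w hw => by
        have h1 : HasDerivAt (fun z => L z - deriv L 0 * z) (deriv L w - deriv L 0 * 1) w :=
          (hball w hw).2.differentiableAt.hasDerivAt.sub ((hasDerivAt_id w).const_mul _)
        rw [h1.deriv, hconst w hw]
        simp) hz h0
  refine hne (deriv L 0) (Metric.eventually_nhds_iff_ball.2 ⟨r, hr, fun z hz => ?_⟩)
  have := hconst' z hz
  rw [hL0] at this
  linear_combination this

theorem exists_local_log {Φ : ℂ → ℂ} (hΦ : AnalyticAt ℂ Φ 0) (h0 : Φ 0 ≠ 0) :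
    ∃ L : ℂ → ℂ, AnalyticAt ℂ L 0 ∧ L 0 = 0 ∧ ∀ᶠ z in 𝓝 0, Φ z = Φ 0 * Complex.exp (L z) := by
  have hd : AnalyticAt ℂ (fun z => Φ z / Φ 0) 0 := hΦ.div analyticAt_const h0
  refine ⟨fun z => Complex.log (Φ z / Φ 0), hd.clog (by simp [h0]), by simp [h0], ?_⟩
  filter_upwards [hΦ.continuousAt.eventually_ne h0] with z hz
  rw [Complex.exp_log (div_ne_zero hz h0), mul_div_cancel₀ _ h0]

section Rays

variable {L ψ : ℂ → ℂ} {c : ℂ} {q : ℕ}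

theorem tendsto_ofReal_mul (w : ℂ) : Tendsto (fun s : ℝ => (s : ℂ) * w) (𝓝[>] 0) (𝓝 0) :=
  ((Complex.continuous_ofReal.mul continuous_const).tendsto' 0 0 (by simp)).mono_left
    nhdsWithin_le_nhds

theorem tendsto_re_pow_mul (hψ : AnalyticAt ℂ ψ 0) (w : ℂ) :
    Tendsto (fun s : ℝ => (w ^ q * ψ (s * w)).re) (𝓝[>] 0) (𝓝 (w ^ q * ψ 0).re) :=
  (Complex.continuous_re.tendsto _).comp
    ((hψ.continuousAt.tendsto.comp (tendsto_ofReal_mul w)).const_mul _)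

theorem eventually_re_eq (hL : ∀ᶠ z in 𝓝 0, L z = c * z + z ^ q * ψ z) (w : ℂ) :
    ∀ᶠ s : ℝ in 𝓝[>] 0, (L (s * w)).re = s * (c * w).re + s ^ q * (w ^ q * ψ (s * w)).re := by
  filter_upwards [(tendsto_ofReal_mul w).eventually hL] with s hs
  rw [hs, Complex.add_re, mul_pow, ← Complex.re_ofReal_mul, ← Complex.re_ofReal_mul]
  push_cast
  ring_nf

/-- Choose `w` with `w^q ψ(0) = -1` and `Re (c w) ≤ 0`: the linear part does not help and the
remainder is strictly negative. -/
theorem exists_ray_neg (hψ : AnalyticAt ℂ ψ 0) (hψ0 : ψ 0 ≠ 0) (hq : 2 ≤ q)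
    (hL : ∀ᶠ z in 𝓝 0, L z = c * z + z ^ q * ψ z) :
    ∃ w : ℂ, w ≠ 0 ∧ ∀ᶠ s : ℝ in 𝓝[>] 0, (L (s * w)).re < 0 := by
  obtain ⟨w, hw, hcw⟩ := exists_pow_mul_eq_one_re_nonneg (-c) (-ψ 0) (neg_ne_zero.2 hψ0) hq
  refine ⟨w, fun h => ?_, ?_⟩
  · rw [h, zero_pow (by omega), zero_mul] at hw
    exact zero_ne_one hw
  · have hlim := tendsto_re_pow_mul (q := q) hψ w
    have e : w ^ q * ψ 0 = -1 := by linear_combination -hw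
    rw [e] at hlim
    filter_upwards [eventually_re_eq hL w, hlim.eventually_lt_const (u := 0) (by simp),
      self_mem_nhdsWithin] with s h1 h2 h3
    rw [h1]
    have h4 : (c * w).re ≤ 0 := by simpa [neg_mul] using hcw
    have h5 : 0 < s ^ q := pow_pos h3 q
    have h6 : 0 < s := h3
    nlinarith

/-- Choose `w` with `w^q ψ(0) = 1` and `Re (c w) ≥ 0`. Passing from `s` to `κ s` scales the linear
part by `κ`, but the remainder asymptotically by `κ^q < κ`. -/
theorem exists_ray_pos (hψ : AnalyticAt ℂ ψ 0) (hψ0 : ψ 0 ≠ 0) (hq : 2 ≤ q)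
    (hL : ∀ᶠ z in 𝓝 0, L z = c * z + z ^ q * ψ z) :
    ∃ w : ℂ, w ≠ 0 ∧ (∀ᶠ s : ℝ in 𝓝[>] 0, 0 < (L (s * w)).re) ∧
      ∀ κ : ℝ, 0 < κ → κ < 1 →
        ∀ᶠ s : ℝ in 𝓝[>] 0, (L ((κ * s : ℝ) * w)).re < κ * (L (s * w)).re := by
  obtain ⟨w, hw, hcw⟩ := exists_pow_mul_eq_one_re_nonneg c (ψ 0) hψ0 hq
  have hlim := tendsto_re_pow_mul (q := q) hψ w
  rw [hw, Complex.one_re] at hlim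
  refine ⟨w, fun h => ?_, ?_, fun κ hκ hκ1 => ?_⟩
  · rw [h, zero_pow (by omega), zero_mul] at hw
    exact zero_ne_one hw
  · filter_upwards [eventually_re_eq hL w, hlim.eventually_const_lt zero_lt_one,
      self_mem_nhdsWithin] with s h1 h2 h3
    rw [h1]
    have h5 : 0 < s ^ q := pow_pos h3 q
    have h6 : 0 < s := h3
    positivity
  · have hscale : Tendsto (fun s : ℝ => κ * s) (𝓝[>] 0) (𝓝[>] 0) := by
      refine tendsto_nhdsWithin_iff.2 ⟨?_, ?_⟩
      · exact ((continuous_const.mul continuous_id).tendsto' 0 0 (by simp)).mono_left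
          nhdsWithin_le_nhds
      · filter_upwards [self_mem_nhdsWithin] with s hs
        exact mul_pos hκ hs
    have hκq : κ ^ q < κ := pow_lt_self_of_lt_one₀ hκ hκ1 (by omega)
    have hlt := ((hlim.comp hscale).const_mul (κ ^ q)).eventually_lt (hlim.const_mul κ)
      (by simpa using hκq)
    filter_upwards [eventually_re_eq hL w, hscale.eventually (eventually_re_eq hL w), hlt,
      self_mem_nhdsWithin] with s h1 h2 h3 h4
    rw [h1, h2, mul_pow]
    have h5 : 0 < s ^ q := pow_pos h4 q
    simp only [Function.comp_apply] at h3
    have := mul_lt_mul_of_pos_left h3 h5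
    linarith

end Rays

/-- The real part of a holomorphic function is strictly convex along a suitable segment through any
point where the second derivative does not vanish. -/
theorem exists_strictConvexOn_re {L : ℂ → ℂ} {v : ℂ} (hL : AnalyticAt ℂ L v)
    (h2 : deriv (deriv L) v ≠ 0) :
    ∃ w : ℂ, w ≠ 0 ∧ ∀ᶠ δ : ℝ in 𝓝[>] 0,
      StrictConvexOn ℝ (Set.Ioo (-δ) δ) fun t : ℝ => (L (v + t * w)).re := by
  -- With this `w` the second derivative of `t ↦ Re L(v + t w)` at `0` equals `1`.
  obtain ⟨w, hw⟩ := IsAlgClosed.exists_pow_nat_eq (deriv (deriv L) v)⁻¹ two_pos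
  have hline : Continuous fun t : ℝ => v + t * w := by fun_prop
  have h0 : v + ((0 : ℝ) : ℂ) * w = v := by simp
  have hpos : ∀ᶠ t : ℝ in 𝓝 0, AnalyticAt ℂ L (v + t * w) ∧
      0 < (deriv (deriv L) (v + t * w) * w * w).re := by
    have hA : ∀ᶠ z in 𝓝 v, AnalyticAt ℂ L z ∧ 0 < (deriv (deriv L) z * w * w).re := by
      refine hL.eventually_analyticAt.and ?_
      have hc : ContinuousAt (fun z => (deriv (deriv L) z * w * w).re) v :=
        Complex.continuous_re.continuousAt.comp
          ((hL.deriv.deriv.continuousAt.mul continuousAt_const).mul continuousAt_const)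
      refine hc.eventually_const_lt ?_
      beta_reduce
      rw [mul_assoc, ← sq, hw, mul_inv_cancel₀ h2]
      simp
    exact (hline.tendsto' 0 v h0).eventually hA
  obtain ⟨r, hr, hball⟩ := Metric.eventually_nhds_iff_ball.1 hpos
  refine ⟨w, fun h => ?_, ?_⟩
  · rw [h] at hw
    exact inv_ne_zero h2 (by simpa using hw.symm)
  filter_upwards [Ioo_mem_nhdsGT hr] with δ hδ
  have hmem : ∀ t ∈ Set.Ioo (-δ) δ, t ∈ Metric.ball (0 : ℝ) r := fun t ht => by
    rw [mem_ball_zero_iff, Real.norm_eq_abs]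
    exact (abs_lt.2 ht).trans hδ.2
  have hlineC : ∀ t : ℝ, HasDerivAt (fun ζ : ℂ => v + ζ * w) w t := fun t => by
    simpa using ((hasDerivAt_id (t : ℂ)).mul_const w).const_add v
  have hd1 : ∀ t ∈ Set.Ioo (-δ) δ, HasDerivAt (fun t : ℝ => (L (v + t * w)).re)
      (deriv L (v + t * w) * w).re t := fun t ht =>
    ((hball t (hmem t ht)).1.differentiableAt.hasDerivAt.comp (t : ℂ) (hlineC t)).real_of_complex
  have hd2 : ∀ t ∈ Set.Ioo (-δ) δ, HasDerivAt (fun t : ℝ => (deriv L (v + t * w) * w).re)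
      (deriv (deriv L) (v + t * w) * w * w).re t := fun t ht =>
    HasDerivAt.real_of_complex (e := fun ζ : ℂ => deriv L (v + ζ * w) * w)
      ((HasDerivAt.comp (h₂ := deriv L) (t : ℂ)
        (hball t (hmem t ht)).1.deriv.differentiableAt.hasDerivAt (hlineC t)).mul_const w)
  refine strictConvexOn_of_deriv2_pos (convex_Ioo _ _)
    (fun t ht => (hd1 t ht).continuousAt.continuousWithinAt) fun t ht => ?_
  rw [interior_Ioo] at ht
  have he : deriv (fun t : ℝ => (L (v + t * w)).re) =ᶠ[𝓝 t]
      fun t : ℝ => (deriv L (v + t * w) * w).re := by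
    filter_upwards [isOpen_Ioo.mem_nhds ht] with s hs using (hd1 s hs).deriv
  change 0 < deriv (deriv fun t : ℝ => (L (v + t * w)).re) t
  rw [he.deriv_eq, (hd2 t ht).deriv]
  exact (hball t (hmem t ht)).2

/-- The local geometry of `|Φ|` near the origin that drives the construction of hypercyclic
algebras. -/
theorem exists_geometry {Φ : ℂ → ℂ} (hΦ : Differentiable ℂ Φ) (h0 : ‖Φ 0‖ = 1)
    (hne : ∀ c : ℂ, ¬ ∀ᶠ z in 𝓝 0, Φ z = Φ 0 * Complex.exp (c * z)) {m : ℕ} (hm : 1 ≤ m) :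
    ∃ (w₀ v w : ℂ) (δ M : ℝ), w₀ ≠ 0 ∧ w ≠ 0 ∧ 0 < δ ∧ 1 < M ∧
      (∀ t : ℝ, 0 < t → t < δ → ‖Φ (t * w₀)‖ < 1) ∧
      (∀ z : ℂ, ‖z - v‖ < δ → M ^ m < ‖Φ z‖) ∧
      (∀ k : ℕ, 1 ≤ k → k < m → ∀ z : ℂ, ‖z - k / m * v‖ < δ → ‖Φ z‖ < M ^ k) ∧
      StrictConvexOn ℝ (Set.Ioo (-δ) δ) fun t : ℝ => Real.log ‖Φ (v + t * w)‖ := by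
  have h0' : Φ 0 ≠ 0 := norm_ne_zero_iff.1 (by rw [h0]; exact one_ne_zero)
  obtain ⟨L, hL, hL0, hLΦ⟩ := exists_local_log (hΦ.analyticAt 0) h0'
  have hLne : ∀ c : ℂ, ¬ ∀ᶠ z in 𝓝 0, L z = c * z := fun c h =>
    hne c (by filter_upwards [h, hLΦ] with z h1 h2; rw [h2, h1])
  obtain ⟨c, q, ψ, hq, hψ, hψ0, hLψ⟩ := exists_eq_linear_add_pow_mul hL hL0 hLne
  have hexp : ∀ᶠ z in 𝓝 0, ‖Φ z‖ = Real.exp (L z).re := by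
    filter_upwards [hLΦ] with z hz
    rw [hz, norm_mul, h0, one_mul, Complex.norm_exp]
  have hmR : (0 : ℝ) < m := by exact_mod_cast hm
  obtain ⟨w₀, hw₀, hneg⟩ := exists_ray_neg hψ hψ0 hq hLψ
  obtain ⟨w₁, hw₁, hpos, hscale⟩ := exists_ray_pos hψ hψ0 hq hLψ
  have hκ : ∀ k ∈ Finset.Ioo 0 m, (0 : ℝ) < k / m ∧ (k / m : ℝ) < 1 := fun k hk => by
    rw [Finset.mem_Ioo] at hk
    have h1 : (0 : ℝ) < k := by exact_mod_cast hk.1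
    have h2 : (k : ℝ) < m := by exact_mod_cast hk.2
    exact ⟨by positivity, (div_lt_one hmR).2 h2⟩
  have hne0 : Tendsto (fun s : ℝ => (s : ℂ) * w₁) (𝓝[>] 0) (𝓝[≠] 0) := by
    refine tendsto_nhdsWithin_iff.2 ⟨tendsto_ofReal_mul w₁, ?_⟩
    filter_upwards [self_mem_nhdsWithin] with s hs
    exact mul_ne_zero (by exact_mod_cast (ne_of_gt hs)) hw₁
  have hall : ∀ᶠ s : ℝ in 𝓝[>] 0, ∀ k ∈ Finset.Ioo 0 m,
      (L ((k / m * s : ℝ) * w₁)).re < (k / m : ℝ) * (L (s * w₁)).re ∧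
      ‖Φ ((k / m * s : ℝ) * w₁)‖ = Real.exp (L ((k / m * s : ℝ) * w₁)).re := by
    refine (Filter.eventually_all_finset _).2 fun k hk => (hscale _ (hκ k hk).1 (hκ k hk).2).and ?_
    have ht : Tendsto (fun s : ℝ => ((k / m * s : ℝ) : ℂ) * w₁) (𝓝[>] 0) (𝓝 0) := by
      refine Tendsto.mono_left (Continuous.tendsto' ?_ 0 0 (by simp)) nhdsWithin_le_nhds
      fun_prop
    exact ht.eventually hexp
  obtain ⟨s, hs1, hs2, hs3, hs4⟩ := (hpos.and (hall.and
    (((tendsto_ofReal_mul w₁).eventually (hexp.eventually_nhds.and hL.eventually_analyticAt)).and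
      (hne0.eventually (eventually_deriv_deriv_ne_zero hL hL0 hLne))))).exists
  set v : ℂ := s * w₁ with hv
  obtain ⟨w, hw, hconv⟩ := exists_strictConvexOn_re hs3.2 hs4
  -- Taking `H` slightly below `Re L(v)` and `M = e^{H/m}` makes the inequalities at `v` and at
  -- every `k v / m` strict, so that they persist on small balls.
  obtain ⟨H, hH0, hHv, hHk⟩ : ∃ H : ℝ, 0 < H ∧ H < (L v).re ∧ ∀ k ∈ Finset.Ioo 0 m,
      (L ((k / m * s : ℝ) * w₁)).re < (k / m : ℝ) * H := by
    have : ∀ᶠ H in 𝓝[<] (L v).re, 0 < H ∧ H < (L v).re ∧ ∀ k ∈ Finset.Ioo 0 m,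
        (L ((k / m * s : ℝ) * w₁)).re < (k / m : ℝ) * H := by
      refine Eventually.and (nhdsWithin_le_nhds (eventually_gt_nhds hs1)) (Eventually.and
        eventually_mem_nhdsWithin
        ((Filter.eventually_all_finset _).2 fun k hk => nhdsWithin_le_nhds ?_))
      exact (continuous_const.mul continuous_id).continuousAt.eventually_const_lt (hs2 k hk).1
    exact this.exists
  have hMpow : ∀ k : ℕ, Real.exp (H / m) ^ k = Real.exp (k / m * H) := fun k => by
    rw [← Real.exp_nat_mul]; ring_nf
  have hball : ∀ {p : ℂ → Prop} {z₀ : ℂ}, (∀ᶠ z in 𝓝 z₀, p z) →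
      ∀ᶠ δ : ℝ in 𝓝[>] 0, ∀ z, ‖z - z₀‖ < δ → p z := fun {p z₀} h => by
    obtain ⟨r, hr, hb⟩ := Metric.eventually_nhds_iff.1 h
    filter_upwards [Ioo_mem_nhdsGT hr] with δ hδ z hz
    exact hb (by rw [dist_eq_norm]; exact hz.trans hδ.2)
  have hA : ∀ᶠ δ : ℝ in 𝓝[>] 0, ∀ t : ℝ, 0 < t → t < δ → ‖Φ (t * w₀)‖ < 1 := by
    have h := hneg.and ((tendsto_ofReal_mul w₀).eventually hexp)
    obtain ⟨r, hr, hb⟩ := mem_nhdsGT_iff_exists_Ioo_subset.1 h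
    filter_upwards [Ioo_mem_nhdsGT hr] with δ hδ t ht0 ht
    obtain ⟨h1, h2⟩ := hb ⟨ht0, ht.trans hδ.2⟩
    rw [h2]
    exact Real.exp_lt_one_iff.2 h1
  have hD : ∀ᶠ δ : ℝ in 𝓝[>] 0, ∀ z, ‖z - v‖ < δ → Real.exp (H / m) ^ m < ‖Φ z‖ := by
    refine hball (hΦ.continuous.norm.continuousAt.eventually_const_lt ?_)
    beta_reduce
    rw [hMpow, hs3.1.self_of_nhds, div_self hmR.ne', one_mul]
    exact Real.exp_lt_exp.2 hHv
  have hB : ∀ᶠ δ : ℝ in 𝓝[>] 0, ∀ k ∈ Finset.Ioo 0 m, ∀ z : ℂ, ‖z - k / m * v‖ < δ →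
      ‖Φ z‖ < Real.exp (H / m) ^ k := by
    refine (Filter.eventually_all_finset _).2 fun k hk =>
      hball (hΦ.continuous.norm.continuousAt.eventually_lt_const ?_)
    have e : (k / m * v : ℂ) = ((k / m * s : ℝ) : ℂ) * w₁ := by rw [hv]; push_cast; ring
    beta_reduce
    rw [hMpow, e, (hs2 k hk).2]
    exact Real.exp_lt_exp.2 (hHk k hk)
  have hC : ∀ᶠ δ : ℝ in 𝓝[>] 0,
      StrictConvexOn ℝ (Set.Ioo (-δ) δ) fun t : ℝ => Real.log ‖Φ (v + t * w)‖ := by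
    have hlog : ∀ᶠ t : ℝ in 𝓝 0, (L (v + t * w)).re = Real.log ‖Φ (v + t * w)‖ := by
      have hline : Continuous fun t : ℝ => v + t * w := by fun_prop
      filter_upwards [(hline.tendsto' 0 v (by simp)).eventually hs3.1] with t ht
      rw [ht, Real.log_exp]
    obtain ⟨r, hr, hb⟩ := Metric.eventually_nhds_iff.1 hlog
    filter_upwards [Ioo_mem_nhdsGT hr, hconv] with δ hδ hc
    refine hc.congr fun t ht => hb ?_
    rw [Real.dist_eq, sub_zero]
    exact (abs_lt.2 ht).trans hδ.2
  obtain ⟨δ, hδ, h1, h2, h3, h4⟩ :=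
    (eventually_mem_nhdsWithin.and (hA.and (hD.and (hB.and hC)))).exists
  refine ⟨w₀, v, w, δ, Real.exp (H / m), hw₀, hw, hδ, Real.one_lt_exp_iff.2 (by positivity),
    h1, h2, fun k hk hkm => h3 k (Finset.mem_Ioo.2 ⟨hk, hkm⟩), h4⟩

/-! ### Contracting factors and the approximating vectors -/

/-- The logarithm of the left side is `log |Φ|` at the mean parameter minus the mean of the values
of `log |Φ|`; strict Jensen makes it negative. -/
theorem norm_prod_mul_lt_one {Φ : ℂ → ℂ} {v w : ℂ} {S : Set ℝ} {m : ℕ} (hm : 1 ≤ m)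
    (hconv : StrictConvexOn ℝ S fun t : ℝ => Real.log ‖Φ (v + t * w)‖)
    (hne : ∀ t ∈ S, Φ (v + t * w) ≠ 0) {t : Fin m → ℝ} (ht : ∀ j, t j ∈ S)
    (hnc : ∃ i j, t i ≠ t j) {τ : Fin m → ℂ} (hτ : ∀ j, τ j ^ m = (Φ (v + t j * w))⁻¹) :
    ‖(∏ j, τ j) * Φ (∑ j, (v + t j * w) / m)‖ < 1 := by
  have hmR : (0 : ℝ) < m := by exact_mod_cast hm
  have hmC : (m : ℂ) ≠ 0 := by exact_mod_cast hmR.ne'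
  have hsum : ∑ _j : Fin m, (1 / m : ℝ) = 1 := by
    simp [hmR.ne']
  obtain ⟨i, j, hij⟩ := hnc
  have hlt := hconv.map_sum_lt (t := Finset.univ) (w := fun _ => (1 / m : ℝ)) (p := t)
    (fun _ _ => by positivity) hsum (fun j _ => ht j)
    ⟨i, Finset.mem_univ _, j, Finset.mem_univ _, hij⟩
  have hmem := hconv.1.sum_mem (t := Finset.univ) (w := fun _ => (1 / m : ℝ)) (z := t)
    (fun _ _ => by positivity) hsum (fun j _ => ht j)
  set a := ∑ j, (1 / m : ℝ) • t j
  have hav : ∑ j, (v + t j * w) / m = v + a * w := by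
    simp only [a, smul_eq_mul, Complex.ofReal_sum, Complex.ofReal_mul, add_div,
      Finset.sum_add_distrib, Finset.sum_mul]
    congr 1
    · simp [mul_div_cancel₀ _ hmC]
    · exact Finset.sum_congr rfl fun j _ => by push_cast; ring
  have hτ0 : ∀ j, τ j ≠ 0 := fun j h => by
    have := hτ j
    rw [h, zero_pow (by omega)] at this
    exact inv_ne_zero (hne _ (ht j)) this.symm
  have hlog : ∀ j, Real.log ‖τ j‖ = -((1 / m : ℝ) * Real.log ‖Φ (v + t j * w)‖) := fun j => by
    have h := congrArg (fun z : ℂ => Real.log ‖z‖) (hτ j)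
    simp only [norm_pow, Real.log_pow, norm_inv, Real.log_inv] at h
    field_simp
    linarith
  have hpos : 0 < ‖(∏ j, τ j) * Φ (∑ j, (v + t j * w) / m)‖ := by
    rw [hav]
    exact norm_pos_iff.2 (mul_ne_zero (Finset.prod_ne_zero_iff.2 fun j _ => hτ0 j) (hne a hmem))
  rw [← Real.log_neg_iff hpos, hav, norm_mul, norm_prod, Real.log_mul
    (Finset.prod_ne_zero_iff.2 fun j _ => norm_ne_zero_iff.2 (hτ0 j))
    (norm_ne_zero_iff.2 (hne a hmem)), Real.log_prod fun j _ => norm_ne_zero_iff.2 (hτ0 j),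
    Finset.sum_congr rfl fun j _ => hlog j, Finset.sum_neg_distrib]
  simp only [smul_eq_mul] at hlt
  linarith

namespace EntireFunctions

variable {Φ : EntireFunctions} {T : EntireFunctions →L[ℂ] EntireFunctions}

theorem IsSymbolOperator.pow_apply_sum_pow (hT : IsSymbolOperator Φ T) {ι : Type*} [Fintype ι]
    (α σ ν : ι → ℂ) (n N : ℕ) :
    (T ^ N) ((∑ i, (α i * σ i ^ N) • expFun (ν i)) ^ n) =
      ∑ s : Fin n → ι, ((∏ j, α (s j)) * ((∏ j, σ (s j)) * Φ (∑ j, ν (s j))) ^ N) •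
        expFun (∑ j, ν (s j)) := by
  rw [Fintype.sum_pow, map_sum]
  refine Finset.sum_congr rfl fun s _ => ?_
  rw [Finset.prod_smul, prod_expFun, map_smul, hT.pow_apply_expFun, smul_smul,
    Finset.prod_mul_distrib, Finset.prod_pow, mul_pow]
  congr 1
  ring

theorem tendsto_smul_pow_zero (c : ℂ) {r : ℂ} (hr : ‖r‖ < 1) (f : EntireFunctions) :
    Tendsto (fun N : ℕ => (c * r ^ N) • f) atTop (𝓝 0) := by
  have h := ((tendsto_pow_atTop_nhds_zero_of_norm_lt_one hr).const_mul c).smul_const f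
  simpa using h

/-- Every product of `n ≤ m` exponentials, other than an `m`-th power of a single expanding one, is
mapped to an exponential with a contracting factor. -/
theorem norm_prod_sum_lt_one {A B : Type*} {w₀ v w : ℂ} {δ δ' M : ℝ} {m : ℕ} (hm : 1 ≤ m)
    (hM : 1 < M) (hδ' : m * (δ' * (1 + ‖w₀‖ + ‖w‖)) < δ)
    (hA : ∀ t : ℝ, 0 < t → t < δ → ‖Φ (t * w₀)‖ < 1)
    (hD : ∀ t : ℝ, 0 < t → t < δ' → M ^ m < ‖Φ (v + t * w)‖)
    (hB : ∀ k : ℕ, 1 ≤ k → k < m → ∀ z : ℂ, ‖z - k / m * v‖ < δ → ‖Φ z‖ < M ^ k)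
    (hC : StrictConvexOn ℝ (Set.Ioo 0 δ') fun t : ℝ => Real.log ‖Φ (v + t * w)‖)
    {p : A → ℝ} (hp : ∀ a, p a ∈ Set.Ioo 0 δ') {r : B → ℝ} (hr : ∀ b, r b ∈ Set.Ioo 0 δ')
    (hrinj : Function.Injective r) {τ : B → ℂ} (hτ : ∀ b, τ b ^ m = (Φ (v + r b * w))⁻¹)
    {n : ℕ} (hn : 1 ≤ n) (hnm : n ≤ m) (s : Fin n → A ⊕ B)
    (hs : ¬ (n = m ∧ ∃ b, s = fun _ => Sum.inr b)) :
    ‖(∏ j, Sum.elim (fun _ => 1) τ (s j)) *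
      Φ (∑ j, Sum.elim (fun a => (p a : ℂ) * w₀) (fun b => (v + r b * w) / m) (s j))‖ < 1 := by
  have hmR : (1 : ℝ) ≤ m := by exact_mod_cast hm
  have hm0 : (m : ℂ) ≠ 0 := by exact_mod_cast (by omega : m ≠ 0)
  have hM0 : 0 < M := by linarith
  have hnR : (1 : ℝ) ≤ n := by exact_mod_cast hn
  have hnmR : (n : ℝ) ≤ m := by exact_mod_cast hnm
  have : NeZero n := ⟨by omega⟩
  have hδ0 : 0 < δ' := by
    rcases s 0 with a | b
    · exact (hp a).1.trans (hp a).2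
    · exact (hr b).1.trans (hr b).2
  -- Each frequency is `(κ / m) v` plus a small error `e`, so `k` counts the expanding exponentials
  -- in the product and the total frequency is near `(k / m) v`.
  set κ : A ⊕ B → ℕ := Sum.elim (fun _ => 0) (fun _ => 1) with hκ
  set e : A ⊕ B → ℂ := Sum.elim (fun a => (p a : ℂ) * w₀) (fun b => r b * w / m) with he
  set k := ∑ j, κ (s j) with hk
  have hκ1 : ∀ i, κ i ≤ 1 := by rintro (a | b) <;> simp [hκ]
  have hkn : k ≤ n := by
    simpa using Finset.sum_le_card_nsmul Finset.univ (fun j => κ (s j)) 1 fun j _ => hκ1 _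
  have hτM : ∀ b, ‖τ b‖ ≤ M⁻¹ := fun b => by
    have h1 := congrArg norm (hτ b)
    rw [norm_pow, norm_inv] at h1
    refine le_of_lt (lt_of_pow_lt_pow_left₀ m (by positivity) ?_)
    rw [h1, inv_pow]
    exact inv_strictAnti₀ (by positivity) (hD _ (hr b).1 (hr b).2)
  rcases Nat.eq_zero_or_pos k with hk0 | hk0
  · have hinl : ∀ j, ∃ a, s j = Sum.inl a := fun j => by
      have h := (Finset.sum_eq_zero_iff.1 hk0) j (Finset.mem_univ _)
      rcases hsj : s j with a | b
      · exact ⟨a, rfl⟩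
      · rw [hsj] at h
        simp [hκ] at h
    choose a ha using hinl
    simp only [ha, Sum.elim_inl, Finset.prod_const_one, one_mul, ← Finset.sum_mul,
      ← Complex.ofReal_sum]
    refine hA _ (Finset.sum_pos (fun j _ => (hp (a j)).1) Finset.univ_nonempty) ?_
    have h1 : ∑ j, p (a j) ≤ n * δ' := by
      simpa using Finset.sum_le_card_nsmul Finset.univ (fun j => p (a j)) δ'
        fun j _ => (hp (a j)).2.le
    have h2 : n * δ' ≤ m * (δ' * (1 + ‖w₀‖ + ‖w‖)) := by
      have : δ' ≤ δ' * (1 + ‖w₀‖ + ‖w‖) :=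
        le_mul_of_one_le_right hδ0.le (by linarith [norm_nonneg w₀, norm_nonneg w])
      gcongr
    linarith
  -- For `0 < k < m`, the `k` roots contribute at most `M^(-k)`, while `|Φ| < M^k` near `(k / m) v`.
  -- If `k = m`, all factors are expanding but not all equal, and strict convexity applies.
  rcases lt_or_ge k m with hkm | hkm
  · have hprod : ‖∏ j, Sum.elim (fun _ => (1 : ℂ)) τ (s j)‖ ≤ M⁻¹ ^ k := by
      rw [norm_prod, hk, ← Finset.prod_pow_eq_pow_sum]
      refine Finset.prod_le_prod (fun _ _ => norm_nonneg _) fun j _ => ?_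
      rcases s j with a | b
      · simp [hκ]
      · simpa [hκ] using hτM b
    have hν : ∀ i : A ⊕ B, Sum.elim (fun a => (p a : ℂ) * w₀) (fun b => (v + r b * w) / m) i =
        (κ i : ℂ) / m * v + e i := by
      rintro (a | b)
      · simp [hκ, he]
      · simp only [hκ, he, Sum.elim_inr]
        push_cast
        ring
    have hen : ∀ i, ‖e i‖ ≤ δ' * (1 + ‖w₀‖ + ‖w‖) := by
      have h1 := norm_nonneg w₀
      have h2 := norm_nonneg w
      rintro (a | b)
      · simp only [he, Sum.elim_inl, norm_mul, Complex.norm_real, Real.norm_eq_abs,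
          abs_of_pos (hp a).1]
        exact mul_le_mul (hp a).2.le (by linarith) h1 hδ0.le
      · simp only [he, Sum.elim_inr, norm_mul, norm_div, Complex.norm_real, Real.norm_eq_abs,
          abs_of_pos (hr b).1, Complex.norm_natCast]
        refine (div_le_self (mul_nonneg (hr b).1.le h2) hmR).trans ?_
        exact mul_le_mul (hr b).2.le (by linarith) h2 hδ0.le
    have hΦ := hB k hk0 hkm (∑ j, Sum.elim (fun a => (p a : ℂ) * w₀)
      (fun b => (v + r b * w) / m) (s j)) (by
        simp only [hν, Finset.sum_add_distrib, ← Finset.sum_mul, ← Finset.sum_div]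
        rw [hk, Nat.cast_sum, add_sub_cancel_left]
        refine (norm_sum_le _ _).trans_lt (lt_of_le_of_lt ?_ hδ')
        have h1 : ∑ j, ‖e (s j)‖ ≤ n * (δ' * (1 + ‖w₀‖ + ‖w‖)) := by
          simpa using Finset.sum_le_card_nsmul Finset.univ (fun j => ‖e (s j)‖) _
            fun j _ => hen (s j)
        refine h1.trans ?_
        gcongr)
    rw [norm_mul]
    calc _ ≤ M⁻¹ ^ k * ‖Φ _‖ := by gcongr
      _ < M⁻¹ ^ k * M ^ k := by gcongr
      _ = 1 := by rw [← mul_pow, inv_mul_cancel₀ hM0.ne', one_pow]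
  · obtain rfl : n = m := by omega
    have hinr : ∀ j, ∃ b, s j = Sum.inr b := fun j => by
      rcases hsj : s j with a | b
      · exfalso
        have : k < ∑ _j : Fin n, 1 := Finset.sum_lt_sum (fun j _ => hκ1 (s j))
          ⟨j, Finset.mem_univ _, by rw [hsj]; simp [hκ]⟩
        simp at this
        omega
      · exact ⟨b, rfl⟩
    choose b hb using hinr
    simp only [hb, Sum.elim_inr]
    refine norm_prod_mul_lt_one hm hC (fun t ht => ?_) (fun j => hr (b j)) ?_ fun j => hτ (b j)
    · exact norm_ne_zero_iff.1 (lt_trans (by positivity) (hD t ht.1 ht.2)).ne'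
    · by_contra! hcon
      exact hs ⟨rfl, b 0, funext fun j => by rw [hb, hrinj (hcon j 0)]⟩

theorem IsSymbolOperator.exists_pow_mem (hT : IsSymbolOperator Φ T) (h0 : ‖Φ 0‖ = 1)
    (hne : ∀ c : ℂ, ¬ ∀ᶠ z in 𝓝 0, Φ z = Φ 0 * Complex.exp (c * z)) {m : ℕ} (hm : 1 ≤ m)
    {U V W : Set EntireFunctions} (hU : IsOpen U) (hUn : U.Nonempty) (hV : IsOpen V)
    (hVn : V.Nonempty) (hW : IsOpen W) (hW0 : (0 : EntireFunctions) ∈ W) :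
    ∃ u ∈ U, ∃ N : ℕ, (T ^ N) (u ^ m) ∈ V ∧ ∀ n, 1 ≤ n → n < m → (T ^ N) (u ^ n) ∈ W := by
  obtain ⟨w₀, v, w, δ, M, hw₀, hw, hδ, hM, hA, hD, hB, hC⟩ :=
    exists_geometry (differentiable Φ) h0 hne hm
  have hm0 : m ≠ 0 := by omega
  have hmR : (1 : ℝ) ≤ m := by exact_mod_cast hm
  have hM0 : 0 < M := by linarith
  have hq : 0 < 1 + ‖w₀‖ + ‖w‖ := by positivity
  obtain ⟨δ', hδ'0, hδ'⟩ : ∃ δ' : ℝ, 0 < δ' ∧ m * (δ' * (1 + ‖w₀‖ + ‖w‖)) < δ :=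
    ⟨δ / (2 * m * (1 + ‖w₀‖ + ‖w‖)), by positivity, by field_simp; linarith⟩
  have hδ'q : δ' * (1 + ‖w₀‖ + ‖w‖) < δ :=
    (le_mul_of_one_le_left (by positivity) hmR).trans_lt hδ'
  have hδ'δ : δ' < δ := (le_mul_of_one_le_right hδ'0.le
    (by linarith [norm_nonneg w₀, norm_nonneg w])).trans_lt hδ'q
  have hD' : ∀ t : ℝ, 0 < t → t < δ' → M ^ m < ‖Φ (v + t * w)‖ := fun t h1 h2 => by
    refine hD _ ?_
    rw [add_sub_cancel_left, norm_mul, Complex.norm_real, Real.norm_eq_abs, abs_of_pos h1]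
    refine lt_of_le_of_lt ?_ hδ'q
    exact mul_le_mul h2.le (by linarith [norm_nonneg w₀]) (norm_nonneg w) hδ'0.le
  have hC' := hC.subset (Set.Ioo_subset_Ioo (by linarith) hδ'δ.le : Set.Ioo 0 δ' ⊆ _)
    (convex_Ioo _ _)
  obtain ⟨f₀, hf₀U, hf₀⟩ := (dense_span_expFun 0 hw₀ hδ'0).exists_mem_open hU hUn
  obtain ⟨g₀, hg₀V, hg₀⟩ := (dense_span_expFun v hw hδ'0).exists_mem_open hV hVn
  rw [SetLike.mem_coe, Submodule.mem_span_image_iff_exists_fun] at hf₀U hg₀V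
  obtain ⟨A, hAs, x, hx⟩ := hf₀U
  obtain ⟨B, hBs, y, hy⟩ := hg₀V
  have hroot : ∀ z : ℂ, ∃ ξ : ℂ, ξ ^ m = z := fun z =>
    IsAlgClosed.exists_pow_nat_eq z (by omega)
  choose root hrootpow using hroot
  -- The `m`-th roots of `y b` restore the coefficients of `g₀` in the `m`-th power, and those of `1
  -- / Φ` make the eigenvalue factors of the diagonal terms exactly `1`.
  let α : A ⊕ B → ℂ := Sum.elim x fun b => root (y b)
  let σ : A ⊕ B → ℂ := Sum.elim (fun _ => 1) fun b => root (Φ (v + (b : ℝ) * w))⁻¹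
  let ν : A ⊕ B → ℂ := Sum.elim (fun a => ((a : ℝ) : ℂ) * w₀) fun b => (v + (b : ℝ) * w) / m
  let u : ℕ → EntireFunctions := fun N => ∑ i, (α i * σ i ^ N) • expFun (ν i)
  have hsmall : ∀ n, 1 ≤ n → n ≤ m → ∀ s : Fin n → A ⊕ B,
      ¬ (n = m ∧ ∃ b, s = fun _ => Sum.inr b) →
      ‖(∏ j, σ (s j)) * Φ (∑ j, ν (s j))‖ < 1 := fun n hn hnm s hs =>
    norm_prod_sum_lt_one hm hM hδ' hA hD' hB hC' (fun a => hAs a.2) (fun b => hBs b.2)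
      Subtype.val_injective (fun b => hrootpow _) hn hnm s hs
  have hu : Tendsto u atTop (𝓝 f₀) := by
    have h : ∀ b : B, ‖σ (Sum.inr b)‖ < 1 := fun b => by
      have h1 := congrArg norm (hrootpow (Φ (v + (b : ℝ) * w))⁻¹)
      rw [norm_pow, norm_inv] at h1
      refine lt_of_pow_lt_pow_left₀ m zero_le_one ?_
      rw [one_pow]
      refine h1.trans_lt (inv_lt_one_of_one_lt₀ ?_)
      exact (one_le_pow₀ hM.le).trans_lt (hD' _ (hBs b.2).1 (hBs b.2).2)
    have h1 : Tendsto (fun N => f₀ + ∑ b : B, (α (Sum.inr b) * σ (Sum.inr b) ^ N) •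
        expFun (ν (Sum.inr b))) atTop (𝓝 (f₀ + ∑ _b : B, 0)) :=
      tendsto_const_nhds.add (tendsto_finsetSum _ fun b _ => tendsto_smul_pow_zero _ (h b) _)
    rw [Finset.sum_const_zero, add_zero] at h1
    refine h1.congr fun N => ?_
    simp only [u, Fintype.sum_sum_type]
    congr 1
    rw [← hx]
    refine Finset.sum_congr rfl fun a _ => ?_
    simp [α, σ, ν]
  have hlow : ∀ n ∈ Finset.Ico 1 m, Tendsto (fun N => (T ^ N) (u N ^ n)) atTop (𝓝 0) := by
    intro n hn
    rw [Finset.mem_Ico] at hn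
    simp only [u, hT.pow_apply_sum_pow]
    have h1 := tendsto_finsetSum Finset.univ fun (s : Fin n → A ⊕ B) _ =>
      tendsto_smul_pow_zero (∏ j, α (s j)) (hsmall n hn.1 hn.2.le s fun h => hn.2.ne h.1)
        (expFun (∑ j, ν (s j)))
    rwa [Finset.sum_const_zero] at h1
  have htop : Tendsto (fun N => (T ^ N) (u N ^ m)) atTop (𝓝 g₀) := by
    classical
    have : NeZero m := ⟨hm0⟩
    have hmC : (m : ℂ) ≠ 0 := by exact_mod_cast hm0
    let c : B → Fin m → A ⊕ B := fun b _ => Sum.inr b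
    have hc : Function.Injective c := fun b b' h => Sum.inr_injective (congrFun h 0)
    -- Termwise limits of the expansion: diagonal terms do not depend on `N`, all others tend to
    -- `0`.
    let l : (Fin m → A ⊕ B) → EntireFunctions := fun s =>
      if s ∈ Set.range c then (∏ j, α (s j)) • expFun (∑ j, ν (s j)) else 0
    have hνc : ∀ b, ∑ j, ν (c b j) = v + (b : ℝ) * w := fun b => by
      simp [c, ν, mul_div_cancel₀ _ hmC]
    have hl : ∑ s, l s = g₀ := by
      rw [← hy]
      refine (Fintype.sum_of_injective c hc _ _ (fun s hs => if_neg hs) fun b => ?_).symm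
      simp only [if_pos (Set.mem_range_self b), hνc]
      simp [c, α, hrootpow]
    rw [← hl]
    simp only [u, hT.pow_apply_sum_pow]
    refine tendsto_finsetSum _ fun s _ => ?_
    by_cases hs : s ∈ Set.range c
    · simp only [l, if_pos hs]
      obtain ⟨b, rfl⟩ := hs
      have hΦ0 : Φ (v + (b : ℝ) * w) ≠ 0 := norm_ne_zero_iff.1
        (lt_trans (by positivity) (hD' _ (hBs b.2).1 (hBs b.2).2)).ne'
      have h1 : (∏ j, σ (c b j)) * Φ (∑ j, ν (c b j)) = 1 := by
        rw [hνc]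
        simp [c, σ, hrootpow, hΦ0]
      simp only [h1, one_pow, mul_one]
      exact tendsto_const_nhds
    · simp only [l, if_neg hs]
      exact tendsto_smul_pow_zero _ (hsmall m hm le_rfl s fun ⟨_, b, hb⟩ => hs ⟨b, hb.symm⟩) _
  obtain ⟨N, h1, h2, h3⟩ := ((hu.eventually (hU.mem_nhds hf₀)).and
    ((htop.eventually (hV.mem_nhds hg₀)).and ((Filter.eventually_all_finset _).2 fun n hn =>
      (hlow n hn).eventually (hW.mem_nhds hW0)))).exists
  exact ⟨u N, h1, N, h2, fun n hn hnm => h3 n (Finset.mem_Ico.2 ⟨hn, hnm⟩)⟩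

/-- The identity theorem turns a local exponential formula into a global one, which the growth
excludes. -/
theorem not_eventually_exponential (hconst : ¬ IsConstant Φ) (hΦ : IsOfSubexponentialGrowth Φ)
    (c : ℂ) : ¬ ∀ᶠ z in 𝓝 0, Φ z = Φ 0 * Complex.exp (c * z) := fun h =>
  not_exponential hconst hΦ c fun z => congrFun (AnalyticOnNhd.eq_of_eventuallyEq
    (f := Φ) (g := fun z => Φ 0 * Complex.exp (c * z))
    (fun z _ => (differentiable Φ).analyticAt z)
    (fun z _ => Differentiable.analyticAt (by fun_prop) z) h) z

end EntireFunctions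

theorem corollary3p6 (Φ : EntireFunctions) (hconst : ¬ EntireFunctions.IsConstant Φ)
    (hgrowth : EntireFunctions.IsOfSubexponentialGrowth Φ) (h0 : ‖Φ 0‖ = 1) :
    ∃ T : EntireFunctions →L[ℂ] EntireFunctions,
      EntireFunctions.IsSymbolOperator Φ T ∧
      ∃ A : NonUnitalSubalgebra ℂ EntireFunctions, IsHypercyclicAlgebra T A := by
  obtain ⟨K, hK, hb⟩ := EntireFunctions.exists_norm_iteratedDeriv_le hconst hgrowth one_half_pos
  obtain ⟨T, hT⟩ := EntireFunctions.exists_isSymbolOperator hK hb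
  exact ⟨T, hT, exists_isHypercyclicAlgebra fun m hm U V W hU hUn hV hVn hW hW0 =>
    hT.exists_pow_mem h0 (EntireFunctions.not_eventually_exponential hconst hgrowth) hm
      hU hUn hV hVn hW hW0⟩
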